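/- C*-algebras are complex and not necessarily unital. Formulas of the continuous logic of C*-algebras are built from norms $\|t\|$ of terms $t$ (*-polynomials with complex coefficients and without constant term) by continuous connectives $f\colon[0,\infty)^2\to[0,\infty)$ and the quantifiers $\inf_{\|x\|\le k}$, $\sup_{\|x\|\le k}$ ($k\in\mathbb N$). An $n$-type is a set of conditions $\varphi\le r$ or $\varphi\ge r$, where $r\ge 0$ is real and $\varphi$ is a formula with free variables among $x_1,\dots,x_n$. It is omitted in $A$ if no $n$-tuple of elements of norm at most $1$ in $A$ satisfies all its conditions. A C*-algebra $A$ is LF if for every finite $S\subseteq A$ and every $\varepsilon>0$ there is a finite-dimensional C*-subalgebra $B$ of $A$ such that every element of $S$ is within distance $\varepsilon$ of an element of $B$. Theorem. There is a countable set of types such that a separable C*-algebra $A$ is LF if and only if it omits all of these types. More precisely, for all finite-dimensional C*-algebras $F$ and all $n\in\mathbb N$ there are formulas $\beta_{F,n}$ with free variables among $x_1,\dots,x_n$ such that $$\beta_{F,n}(a_1,\dots,a_n)^A=\inf_C\max_{1\le i\le n}\operatorname{dist}(a_i,C)$$ for every C*-algebra $A$ and all $a_1,\dots,a_n\in A$ of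 norm at most $1$, where $C$ ranges over the isomorphic copies of $F$ in $A$ and the infimum is taken in $[0,1]$ (so it is $1$ if $A$ contains no copy of $F$, and the maximum over the empty set is $0$); and the set of types can be taken to be $\{\mathbf s_{m,n}: m\ge 1,\ n\ge 0\}$, where $\mathbf s_{m,n}$ consists of the conditions $\beta_{F,n}\ge 1/m$, with $F$ ranging over all finite-dimensional C*-algebras, and the conditions $\|x_i\|\le 1$ for $1\le i\le n$. -/

import Mathlib

open scoped NNReal

universe u

namespace CStarLogic

/-- Terms of the language of (not necessarily unital) C*-algebras in the variables `x i`, `i : Fin n`: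
*-polynomials with complex coefficients and without constant term. -/
inductive Term (n : ℕ) : Type
  | var (i : Fin n) : Term n
  | zero : Term n
  | add (s t : Term n) : Term n
  | mul (s t : Term n) : Term n
  | smul (c : ℂ) (t : Term n) : Term n
  | adj (t : Term n) : Term n

/-- The interpretation of a term in a C*-algebra. -/
def Term.eval {A : Type*} [NonUnitalCStarAlgebra A] {n : ℕ} (a : Fin n → A) : Term n → A
  | .var i => a i
  | .zero => 0
  | .add s t => s.eval a + t.eval a
  | .mul s t => s.eval a * t.eval a
  | .smul c t => c • t.eval a
  | .adj t => star (t.eval a)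

/-- Formulas of the continuous logic of C*-algebras whose free variables are among the `x i`,
`i : Fin n`: norms of terms, continuous connectives on `[0, ∞)`, and infima and suprema over the
ball of radius `k : ℕ`.  The quantifiers bind the last of `n + 1` variables. -/
inductive Formula : ℕ → Type
  | norm {n : ℕ} (t : Term n) : Formula n
  | conn {n : ℕ} (f : C(ℝ≥0 × ℝ≥0, ℝ≥0)) (φ ψ : Formula n) : Formula n
  | inf {n : ℕ} (k : ℕ) (φ : Formula (n + 1)) : Formula n
  | sup {n : ℕ} (k : ℕ) (φ : Formula (n + 1)) : Formula n

/-- The value of a formula at a tuple of a C*-algebra.  (By induction, every formula is bounded on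
bounded sets of tuples, so the suprema below are suprema of bounded nonempty sets.) -/
noncomputable def Formula.eval {A : Type*} [NonUnitalCStarAlgebra A] :
    {n : ℕ} → Formula n → (Fin n → A) → ℝ≥0
  | _, .norm t, a => ‖t.eval a‖₊
  | _, .conn f φ ψ, a => f (φ.eval a, ψ.eval a)
  | _, .inf k φ, a => ⨅ x : {x : A // ‖x‖ ≤ k}, φ.eval (Fin.snoc (α := fun _ => A) a x.1)
  | _, .sup k φ, a => ⨆ x : {x : A // ‖x‖ ≤ k}, φ.eval (Fin.snoc (α := fun _ => A) a x.1)

/-- Conditions `φ ≤ r` and `φ ≥ r`, with `r` a nonnegative real number. -/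
inductive Condition (n : ℕ) : Type
  | le (φ : Formula n) (r : ℝ≥0) : Condition n
  | ge (φ : Formula n) (r : ℝ≥0) : Condition n

/-- The condition holds at the tuple `a`. -/
def Condition.Holds {A : Type*} [NonUnitalCStarAlgebra A] {n : ℕ} (a : Fin n → A) :
    Condition n → Prop
  | .le φ r => φ.eval a ≤ r
  | .ge φ r => r ≤ φ.eval a

/-- An `n`-type (over the empty set) is a set of `n`-ary conditions. -/
abbrev NType (n : ℕ) : Type := Set (Condition n)

/-- The type `t` is realized in `A`: some tuple of the unit ball satisfies all its conditions. -/
def Realizes (A : Type*) [NonUnitalCStarAlgebra A] {n : ℕ} (t : NType n) : Prop :=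
  ∃ a : Fin n → A, (∀ i, ‖a i‖ ≤ 1) ∧ ∀ c ∈ t, c.Holds a

/-- The type `t` is omitted in `A`. -/
def Omits (A : Type*) [NonUnitalCStarAlgebra A] {n : ℕ} (t : NType n) : Prop :=
  ¬ Realizes A t

/-- `A` is LF: every finite subset of `A` is, for every `ε > 0`, within `ε` of a finite-dimensional
C*-subalgebra (a finite-dimensional *-subalgebra is automatically closed). -/
def IsLF (A : Type*) [NonUnitalCStarAlgebra A] : Prop :=
  ∀ (S : Finset A) (ε : ℝ), 0 < ε → ∃ B : NonUnitalStarSubalgebra ℂ A,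
    FiniteDimensional ℂ B ∧ ∀ a ∈ S, ∃ b ∈ B, ‖a - b‖ < ε

/-- For a tuple `a` in the unit ball of `A`: the infimum, taken in `[0, 1]`, of
`max_i dist (a i, C)` over all isomorphic copies `C` of `F` in `A`, that is, over the ranges of
injective *-homomorphisms `F → A`.  Each of these maxima is at most `1`, because `0 ∈ C`;
the value is `1` if `A` contains no copy of `F`. -/
noncomputable def copyDist (F : Type*) [NonUnitalCStarAlgebra F] {A : Type*}
    [NonUnitalCStarAlgebra A] {n : ℕ} (a : Fin n → A) : ℝ :=
  sInf (insert 1 {r : ℝ | ∃ φ : F →⋆ₙₐ[ℂ] A, Function.Injective φ ∧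
    r = ⨆ i : Fin n, Metric.infDist (a i) (Set.range φ)})

/-- Families of formulas `β F n`, where `F` is a finite-dimensional C*-algebra and `β F n` has
free variables among `x 0, …, x (n - 1)`. -/
abbrev FormulaFamily : Type 1 :=
  ∀ (F : Type) [NonUnitalCStarAlgebra F] [FiniteDimensional ℂ F] (n : ℕ), Formula n

/-- The `n`-type consisting of the conditions `β F n ≥ 1 / m`, for all finite-dimensional
C*-algebras `F`, and the conditions `‖x i‖ ≤ 1`, for all `i`. -/
def lfType (β : FormulaFamily) (m n : ℕ) : NType n :=
  {c | ∃ (F : Type) (_ : NonUnitalCStarAlgebra F) (_ : FiniteDimensional ℂ F),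
      c = Condition.ge (β F n) (1 / (m : ℝ≥0))} ∪
    {c | ∃ i : Fin n, c = Condition.le (Formula.norm (Term.var i)) 1}

end CStarLogic

/-! The crux is that the distance from a tuple to the copies of a finite-dimensional `F` is given by
a formula (`exists_formula_copyDist`). Omitting `lfType β m n` then says that every n-tuple in the
unit ball is at distance less than 1/m from a copy of some `F`, and rescaling turns this into LF.

A copy of `F` is coded by the images of a basis. `relDefect` measures how far a tuple violates the
multiplication table, the involution, and a lower norm bound on a finite net. These relations are
stable with a linear estimate: a bounded tuple with small `relDefect` is within O(`relDefect`) of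
the image of the basis under an injective *-homomorphism (`exists_injective_starAlgHom_near`). This
rests on a Newton iteration (`exists_newton_step`): the defect of multiplicativity is formally a
Hochschild 2-cocycle, and the separability idempotent of `F` (`exists_separability_idempotent`)
makes it a coboundary up to an error quadratic in the defect.

Quantifiers range over elements, not scalars. A complex coefficient is therefore coded by two
elements near real multiples of the image of the unit of `F`, and `scalarDefect` detects such
elements by norms alone.

Finally, `gauge` is an exact penalty function: all errors are linear in the defects, so for large
constants its infimum over a ball, cut off at 1, equals the distance instead of only approximating
it (`exists_gauge_le`, `exists_copyDist_le_gauge`). -/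

namespace CStarLogic

/-! ### The trace form and the separability idempotent of a finite-dimensional C*-algebra. -/

section Casimir

variable {F : Type*} [NonUnitalCStarAlgebra F]

theorem eigenvalue_conj_eq {k v : F} (hk : IsSelfAdjoint k) {c : ℂ} (hv : v ≠ 0)
    (h : k * v = c • v) : star c = c := by
  have h1 : star v * k * v = c • (star v * v) := by rw [mul_assoc, h, mul_smul_comm]
  have h2 : star v * k * v = star c • (star v * v) := by
    have := congrArg star h1
    simpa [star_smul, hk.star_eq, mul_assoc] using this
  have h3 : star v * v ≠ 0 := by simpa [CStarRing.star_mul_self_eq_zero_iff] using hv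
  exact smul_left_injective ℂ h3 (h2.symm.trans h1)

/-- If w² = c, then (k + w)(k - w) kills v, so w or -w is an eigenvalue of the self-adjoint k and
hence real. -/
theorem eigenvalue_sq_nonneg {k v : F} (hk : IsSelfAdjoint k) {c : ℂ} (hv : v ≠ 0)
    (h : k * (k * v) = c • v) : ∃ s : ℝ, c = (s : ℂ) ^ 2 := by
  obtain ⟨w, hw⟩ := IsAlgClosed.exists_pow_nat_eq c (n := 2) (by norm_num)
  by_cases h0 : k * v - w • v = 0
  · have := eigenvalue_conj_eq hk hv (sub_eq_zero.1 h0)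
    obtain ⟨r, hr⟩ := Complex.conj_eq_iff_real.1 this
    exact ⟨r, by rw [← hw, hr]⟩
  · have h2 : k * (k * v - w • v) = (-w) • (k * v - w • v) := by
      rw [mul_sub, h, mul_smul_comm, ← hw]
      module
    have := eigenvalue_conj_eq hk h0 h2
    obtain ⟨r, hr⟩ := Complex.conj_eq_iff_real.1 this
    exact ⟨r, by rw [← hw, ← hr]; ring⟩

/-- The trace of left multiplication. -/
noncomputable def regTrace (F : Type*) [NonUnitalCStarAlgebra F] : F →ₗ[ℂ] ℂ :=
  (LinearMap.trace ℂ F).comp (LinearMap.mul ℂ F)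

theorem regTrace_mul_comm (x y : F) : regTrace F (x * y) = regTrace F (y * x) := by
  have h (x y : F) : LinearMap.mul ℂ F (x * y) = LinearMap.mul ℂ F x * LinearMap.mul ℂ F y := by
    ext z; simp [mul_assoc]
  simp only [regTrace, LinearMap.comp_apply, h]
  exact LinearMap.trace_mul_comm ℂ _ _

/-- The eigenvalues of multiplication by k² are squares of reals, so trace zero forces them all to
vanish. The operator is then nilpotent, and a nilpotent self-adjoint element is zero. -/
theorem eq_zero_of_regTrace_sq [FiniteDimensional ℂ F] {k : F} (hk : IsSelfAdjoint k) (h : regTrace F (k * k) = 0) :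
    k = 0 := by
  set T : Module.End ℂ F := LinearMap.mul ℂ F (k * k) with hT
  have hT' : ∀ v, T v = k * (k * v) := fun v => by simp [hT, mul_assoc]
  have hroots : ∀ c ∈ T.charpoly.roots, ∃ s : ℝ, c = (s : ℂ) ^ 2 := by
    intro c hc
    have : T.HasEigenvalue c := by
      rw [Module.End.hasEigenvalue_iff_isRoot_charpoly]
      exact Polynomial.isRoot_of_mem_roots hc
    obtain ⟨v, hv⟩ := this.exists_hasEigenvector
    exact eigenvalue_sq_nonneg hk hv.2 (by rw [← hT']; exact hv.apply_eq_smul)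
  have htr : T.charpoly.roots.sum = 0 := by
    rw [← Module.End.trace_eq_sum_roots_charpoly_of_splits (IsAlgClosed.splits _)]
    exact h
  have hzero : ∀ c ∈ T.charpoly.roots, c = 0 := by
    have h1 : (T.charpoly.roots.map Complex.re).sum = 0 := by
      have := congrArg Complex.reAddGroupHom htr
      rwa [map_multiset_sum, map_zero] at this
    have h2 := Multiset.all_zero_of_le_zero_le_of_sum_eq_zero
      (s := T.charpoly.roots.map Complex.re) (fun x hx => by
        obtain ⟨c, hc, rfl⟩ := Multiset.mem_map.1 hx
        obtain ⟨s, rfl⟩ := hroots c hc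
        norm_cast
        positivity) h1
    intro c hc
    obtain ⟨s, rfl⟩ := hroots c hc
    have := h2 _ (Multiset.mem_map_of_mem Complex.re hc)
    norm_cast at this ⊢
  have hchar : T.charpoly = Polynomial.X ^ Module.finrank ℂ F := by
    have h1 := (IsAlgClosed.splits T.charpoly).eq_prod_roots_of_monic T.charpoly_monic
    have h2 : T.charpoly.roots = Multiset.replicate (Module.finrank ℂ F) 0 := by
      rw [Multiset.eq_replicate]
      refine ⟨?_, hzero⟩
      rw [← T.charpoly_natDegree, (IsAlgClosed.splits T.charpoly).natDegree_eq_card_roots]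
    rw [h2] at h1
    simpa using h1
  obtain ⟨d, hd⟩ := (LinearMap.isNilpotent_iff_charpoly T).2 hchar
  -- Passing from l to l² halves the exponent and stays among self-adjoint elements.
  have key : ∀ j : ℕ, ∀ l : F, IsSelfAdjoint l →
      LinearMap.mul ℂ F l ^ (2 ^ j) = 0 → l = 0 := by
    intro j
    induction j with
    | zero =>
      intro l hl h0
      have := LinearMap.congr_fun h0 l
      simp only [pow_zero, pow_one, LinearMap.mul_apply', LinearMap.zero_apply] at this
      rw [← CStarRing.star_mul_self_eq_zero_iff, hl.star_eq, this]
    | succ j ih =>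
      intro l hl h0
      have h1 : l * l = 0 := by
        refine ih (l * l) (by simp [IsSelfAdjoint, hl.star_eq]) ?_
        have : LinearMap.mul ℂ F (l * l) = LinearMap.mul ℂ F l ^ 2 := by
          ext z; simp [pow_two, mul_assoc]
        rw [this, ← pow_mul, ← pow_succ', h0]
      rw [← CStarRing.star_mul_self_eq_zero_iff, hl.star_eq, h1]
  have hkk : k * k = 0 := by
    refine key d (k * k) (by simp [IsSelfAdjoint, hk.star_eq]) ?_
    exact pow_eq_zero_of_le Nat.lt_two_pow_self.le hd
  rw [← CStarRing.star_mul_self_eq_zero_iff, hk.star_eq, hkk]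

/-- The trace form `(x, y) ↦ Tr (L_{xy})`. -/
noncomputable def regForm (F : Type*) [NonUnitalCStarAlgebra F] : LinearMap.BilinForm ℂ F :=
  (LinearMap.mul ℂ F).compr₂ (regTrace F)

@[simp] theorem regForm_apply (x y : F) : regForm F x y = regTrace F (x * y) := rfl

theorem regForm_isSymm : (regForm F).IsSymm := ⟨fun x y => regTrace_mul_comm x y⟩

/-- With y = x* x x*, the product xy is the square of the self-adjoint element x x*. -/
theorem eq_zero_of_regForm [FiniteDimensional ℂ F] {x : F} (h : ∀ y, regTrace F (x * y) = 0) : x = 0 := by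
  have := eq_zero_of_regTrace_sq (k := x * star x) (by simp [IsSelfAdjoint])
    (by rw [mul_assoc]; exact h _)
  simpa [CStarRing.mul_star_self_eq_zero_iff] using this

theorem regForm_nondegenerate [FiniteDimensional ℂ F] : (regForm F).Nondegenerate :=
  ⟨fun _ h => eq_zero_of_regForm h,
    fun _ h => eq_zero_of_regForm fun y => (regTrace_mul_comm _ _).trans (h y)⟩

/-- A finite-dimensional C*-algebra is unital and has a separability idempotent `∑ e i ⊗ f i`. -/
theorem exists_separability_idempotent (F : Type*) [NonUnitalCStarAlgebra F]
    [FiniteDimensional ℂ F] :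
    ∃ (d : ℕ) (e f : Fin d → F) (u : F),
      (∀ x, u * x = x) ∧ (∀ x, x * u = x) ∧ star u = u ∧ ∑ i, e i * f i = u ∧
      ∀ x, ∃ c : Fin d → Fin d → ℂ, (∀ i, x * e i = ∑ j, c j i • e j) ∧
        ∀ j, f j * x = ∑ i, c j i • f i := by
  set b := Module.finBasis ℂ F
  set f := (regForm F).dualBasis regForm_nondegenerate b with hf
  have hrf : ∀ x i, f.repr x i = regTrace F (x * b i) :=
    fun x i => LinearMap.BilinForm.dualBasis_repr_apply regForm_nondegenerate b x i
  have hrb : ∀ x i, b.repr x i = regTrace F (f i * x) := by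
    intro x i
    have := LinearMap.BilinForm.dualBasis_repr_apply (B := regForm F) regForm_nondegenerate f x i
    rw [hf, LinearMap.BilinForm.dualBasis_dualBasis regForm_nondegenerate regForm_isSymm,
      regForm_apply, regTrace_mul_comm] at this
    exact this
  set u := ∑ i, b i * f i with hu
  -- The diagonal entries of left multiplication by x are Tr(fᵢ x bᵢ), and the trace is cyclic. By
  -- nondegeneracy, u is then a right unit.
  have htr : ∀ x, regTrace F x = regTrace F (x * u) := by
    intro x
    rw [regTrace, LinearMap.comp_apply, LinearMap.trace_eq_matrix_trace ℂ b, Matrix.trace]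
    rw [hu, Finset.mul_sum, ← regTrace, map_sum]
    refine Finset.sum_congr rfl fun i _ => ?_
    rw [Matrix.diag_apply, LinearMap.toMatrix_apply, hrb, ← mul_assoc, regTrace_mul_comm _ (f i)]
    rfl
  have hxu : ∀ x, x * u = x := by
    intro x
    refine (sub_eq_zero.1 (eq_zero_of_regForm (fun y => ?_)))
    rw [regTrace_mul_comm, mul_sub, ← mul_assoc, map_sub, ← htr, sub_self]
  have hsux : ∀ x, star u * x = x := fun x => by
    have := congrArg star (hxu (star x)); simpa using this
  have hsu : star u = u := by rw [← hxu (star u), hsux]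
  refine ⟨_, b, f, u, fun x => by rw [← hsu, hsux], hxu, hsu, rfl, fun x =>
    -- Each of the dual bases gives the coordinates in the other, so one matrix serves both
    -- expansions: ∑ x bᵢ ⊗ fᵢ = ∑ bᵢ ⊗ fᵢ x.
    ⟨fun j i => regTrace F (f j * x * b i), fun i => ?_, fun j => ?_⟩⟩
  · conv_lhs => rw [← b.sum_repr (x * b i)]
    exact Finset.sum_congr rfl fun j _ => by rw [hrb, ← mul_assoc]
  · conv_lhs => rw [← f.sum_repr (f j * x)]
    exact Finset.sum_congr rfl fun i _ => by rw [hrf]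

end Casimir

end CStarLogic

namespace CStarLogic

/-! ### Newton iteration from approximate to exact *-homomorphisms. -/

section Newton

variable {F A : Type*} [NonUnitalCStarAlgebra F] [NonUnitalCStarAlgebra A]

/-- The defect of multiplicativity of a linear map. -/
noncomputable def defect (φ : F →ₗ[ℂ] A) : F →ₗ[ℂ] F →ₗ[ℂ] A :=
  (LinearMap.mul ℂ F).compr₂ φ - (LinearMap.mul ℂ A).compl₁₂ φ φ

theorem defect_apply (φ : F →ₗ[ℂ] A) (x y : F) : defect φ x y = φ (x * y) - φ x * φ y := rfl

theorem map_mul_eq (φ : F →ₗ[ℂ] A) (x y : F) : φ x * φ y = φ (x * y) - defect φ x y := by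
  simp [defect_apply]

/-- Associativity gives the Hochschild 2-cocycle identity exactly, although φ is only approximately
a bimodule action. -/
theorem defect_cocycle (φ : F →ₗ[ℂ] A) (x y z : F) :
    defect φ (x * y) z - defect φ x (y * z) + defect φ x y * φ z = φ x * defect φ y z := by
  simp only [defect_apply, mul_assoc, sub_mul, mul_sub]
  abel

/-- The adjoint `x ↦ (φ x*)*` of a linear map. -/
noncomputable def sharp (φ : F →ₗ[ℂ] A) : F →ₗ[ℂ] A where
  toFun x := star (φ (star x))
  map_add' x y := by simp
  map_smul' c x := by simp [star_smul]

@[simp] theorem sharp_apply (φ : F →ₗ[ℂ] A) (x : F) : sharp φ x = star (φ (star x)) := rfl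

/-- The Hochschild coboundary of `χ` relative to the approximately multiplicative map `φ`. -/
noncomputable def coboundary (φ χ : F →ₗ[ℂ] A) (x y : F) : A :=
  φ x * χ y - χ (x * y) + χ x * φ y

/-- To first order, adding χ subtracts its coboundary from the defect; a Newton step thus has to
solve "coboundary = defect". -/
theorem defect_add (φ χ : F →ₗ[ℂ] A) (x y : F) :
    defect (φ + χ) x y = (defect φ x y - coboundary φ χ x y) - χ x * χ y := by
  simp only [defect_apply, coboundary, LinearMap.add_apply, mul_add, add_mul]
  abel

theorem coboundary_sharp (φ χ : F →ₗ[ℂ] A) (hφ : ∀ x, φ (star x) = star (φ x)) (x y : F) :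
    coboundary φ (sharp χ) x y = star (coboundary φ χ (star y) (star x)) := by
  simp only [coboundary, sharp_apply, star_add, star_sub, star_mul, hφ, star_star]
  abel

theorem defect_star (φ : F →ₗ[ℂ] A) (hφ : ∀ x, φ (star x) = star (φ x)) (x y : F) :
    defect φ x y = star (defect φ (star y) (star x)) := by
  have h : φ (star y * star x) = star (φ (x * y)) := by rw [← star_mul, hφ]
  simp only [defect_apply, h, star_sub, star_mul, hφ, star_star]

theorem coboundary_average (φ χ₁ χ₂ : F →ₗ[ℂ] A) (x y : F) :
    defect φ x y - coboundary φ ((1 / 2 : ℂ) • (χ₁ + χ₂)) x y =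
      (1 / 2 : ℂ) • ((defect φ x y - coboundary φ χ₁ x y) +
        (defect φ x y - coboundary φ χ₂ x y)) := by
  simp only [coboundary, LinearMap.smul_apply, LinearMap.add_apply, mul_smul_comm, smul_mul_assoc,
    mul_add, add_mul]
  module

/-- The first-order correction making an approximately multiplicative map more multiplicative. -/
noncomputable def correction {d : ℕ} (e f : Fin d → F) (u : F) (φ : F →ₗ[ℂ] A) : F →ₗ[ℂ] A :=
  ∑ i, (LinearMap.mulLeft ℂ (φ (e i))).comp (defect φ (f i)) +
    (LinearMap.mulLeft ℂ (φ u)).comp (defect φ u) - defect φ u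

theorem correction_apply {d : ℕ} (e f : Fin d → F) (u : F) (φ : F →ₗ[ℂ] A) (x : F) :
    correction e f u φ x =
      ∑ i, φ (e i) * defect φ (f i) x + φ u * defect φ u x - defect φ u x := by
  simp [correction]

/-- Averaging the cocycle identity over ∑ eᵢ ⊗ fᵢ yields φ(u)·defect up to products of two defects.
Since φ(u) need not act as a unit, the two extra terms of `correction` supply the missing (1 -
φ(u))·defect. -/
theorem defect_sub_coboundary_correction {d : ℕ} {e f : Fin d → F} {u : F}
    (hu1 : ∀ x, u * x = x) (hu2 : ∀ x, x * u = x) (hsum : ∑ i, e i * f i = u)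
    (hcas : ∀ x, ∃ c : Fin d → Fin d → ℂ, (∀ i, x * e i = ∑ j, c j i • e j) ∧
        ∀ j, f j * x = ∑ i, c j i • f i) (φ : F →ₗ[ℂ] A) (x y : F) :
    defect φ x y - coboundary φ (correction e f u φ) x y =
      ∑ i, (defect φ x (e i) * defect φ (f i) y + defect φ (e i) (f i) * defect φ x y) +
        (defect φ x u * defect φ u y + defect φ u u * defect φ x y) := by
  have hc : ∑ i, φ (x * e i) * defect φ (f i) y = ∑ i, φ (e i) * defect φ (f i * x) y := by
    obtain ⟨c, h1, h2⟩ := hcas x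
    simp only [h1, h2, map_sum, map_smul, LinearMap.sum_apply, LinearMap.smul_apply,
      Finset.sum_mul, Finset.mul_sum, smul_mul_assoc, mul_smul_comm]
    rw [Finset.sum_comm]
  have e1 : ∑ i, φ x * (φ (e i) * defect φ (f i) y) =
      ∑ i, φ (e i) * defect φ (f i * x) y - ∑ i, defect φ x (e i) * defect φ (f i) y := by
    rw [← hc, ← Finset.sum_sub_distrib]
    refine Finset.sum_congr rfl fun i _ => ?_
    rw [← mul_assoc, map_mul_eq, sub_mul]
  have e2 : ∑ i, φ (e i) * defect φ (f i * x) y - ∑ i, φ (e i) * defect φ (f i) (x * y) +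
      ∑ i, φ (e i) * defect φ (f i) x * φ y =
      φ u * defect φ x y - ∑ i, defect φ (e i) (f i) * defect φ x y := by
    rw [← Finset.sum_sub_distrib, ← Finset.sum_add_distrib, ← hsum, map_sum, Finset.sum_mul,
      ← Finset.sum_sub_distrib]
    refine Finset.sum_congr rfl fun i _ => ?_
    rw [← sub_mul, ← map_mul_eq, mul_assoc (φ (e i)) (φ (f i)), ← defect_cocycle φ (f i) x y, mul_add, mul_sub,
      mul_assoc]
  have e3 : defect φ u (x * y) = defect φ x y + defect φ u x * φ y - φ u * defect φ x y := by
    rw [← defect_cocycle, hu1]; abel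
  have e4 : φ x * (φ u * defect φ u y) = φ x * defect φ u y - defect φ x u * defect φ u y := by
    rw [← mul_assoc, map_mul_eq, hu2, sub_mul]
  have e5 : φ u * (φ u * defect φ x y) = φ u * defect φ x y - defect φ u u * defect φ x y := by
    rw [← mul_assoc, map_mul_eq, hu1, sub_mul]
  have e6 : coboundary φ (correction e f u φ) x y =
      (∑ i, φ x * (φ (e i) * defect φ (f i) y) - ∑ i, φ (e i) * defect φ (f i) (x * y) +
      ∑ i, φ (e i) * defect φ (f i) x * φ y) +
      (φ x * (φ u * defect φ u y) - φ x * defect φ u y - φ u * defect φ u (x * y)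
        + defect φ u (x * y) + φ u * (defect φ u x * φ y) - defect φ u x * φ y) := by
    simp only [coboundary, correction_apply, mul_add, mul_sub, add_mul, sub_mul, Finset.mul_sum,
      Finset.sum_mul, mul_assoc]
    abel
  have e7 : ∑ i, φ x * (φ (e i) * defect φ (f i) y) - ∑ i, φ (e i) * defect φ (f i) (x * y) +
      ∑ i, φ (e i) * defect φ (f i) x * φ y = φ u * defect φ x y -
      ∑ i, defect φ (e i) (f i) * defect φ x y - ∑ i, defect φ x (e i) * defect φ (f i) y := by
    rw [e1, ← e2]; abel
  rw [e6, e7, e3, e4, mul_sub, mul_add, e5, Finset.sum_add_distrib]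
  abel

theorem norm_correction_le {d : ℕ} {e f : Fin d → F} {u : F} {φ : F →ₗ[ℂ] A} {K ε : ℝ}
    (hK : ∀ x, ‖φ x‖ ≤ K * ‖x‖) (hd : ∀ x y, ‖defect φ x y‖ ≤ ε * ‖x‖ * ‖y‖) (hK0 : 0 ≤ K) (x : F) :
    ‖correction e f u φ x‖ ≤
      (K * (∑ i, ‖e i‖ * ‖f i‖ + ‖u‖ * ‖u‖) + ‖u‖) * ε * ‖x‖ := by
  have h1 : ∀ a b : F, ‖φ a * defect φ b x‖ ≤ K * ε * ‖x‖ * (‖a‖ * ‖b‖) := fun a b => by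
    calc _ ≤ ‖φ a‖ * ‖defect φ b x‖ := norm_mul_le _ _
      _ ≤ (K * ‖a‖) * (ε * ‖b‖ * ‖x‖) := by gcongr; exacts [hK a, hd b x]
      _ = _ := by ring
  rw [correction_apply]
  calc _ ≤ ∑ i, K * ε * ‖x‖ * (‖e i‖ * ‖f i‖) + K * ε * ‖x‖ * (‖u‖ * ‖u‖) + ε * ‖u‖ * ‖x‖ :=
        (norm_sub_le _ _).trans (add_le_add ((norm_add_le _ _).trans
          (add_le_add (norm_sum_le_of_le _ fun i _ => h1 _ _) (h1 _ _))) (hd _ _))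
    _ = _ := by rw [← Finset.mul_sum]; ring

theorem norm_defect_sub_coboundary_le {d : ℕ} {e f : Fin d → F} {u : F}
    (hu1 : ∀ x, u * x = x) (hu2 : ∀ x, x * u = x) (hsum : ∑ i, e i * f i = u)
    (hcas : ∀ x, ∃ c : Fin d → Fin d → ℂ, (∀ i, x * e i = ∑ j, c j i • e j) ∧
        ∀ j, f j * x = ∑ i, c j i • f i) {φ : F →ₗ[ℂ] A} {ε : ℝ}
    (hd : ∀ x y, ‖defect φ x y‖ ≤ ε * ‖x‖ * ‖y‖) (x y : F) :
    ‖defect φ x y - coboundary φ (correction e f u φ) x y‖ ≤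
      2 * (∑ i, ‖e i‖ * ‖f i‖ + ‖u‖ * ‖u‖) * ε ^ 2 * ‖x‖ * ‖y‖ := by
  have h0 : ∀ a b c d : F, ‖defect φ a b * defect φ c d‖ ≤
      ε ^ 2 * (‖a‖ * ‖b‖) * (‖c‖ * ‖d‖) := fun a b c d => by
    calc _ ≤ ‖defect φ a b‖ * ‖defect φ c d‖ := norm_mul_le _ _
      _ ≤ (ε * ‖a‖ * ‖b‖) * (ε * ‖c‖ * ‖d‖) := by
        gcongr
        exacts [(norm_nonneg _).trans (hd a b), hd a b, hd c d]
      _ = _ := by ring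
  have h1 : ∀ a b : F, ‖defect φ x a * defect φ b y + defect φ a b * defect φ x y‖ ≤
      2 * ε ^ 2 * ‖x‖ * ‖y‖ * (‖a‖ * ‖b‖) := fun a b =>
    (norm_add_le_of_le (h0 _ _ _ _) (h0 _ _ _ _)).trans (by apply le_of_eq; ring)
  rw [defect_sub_coboundary_correction hu1 hu2 hsum hcas]
  calc _ ≤ ∑ i, 2 * ε ^ 2 * ‖x‖ * ‖y‖ * (‖e i‖ * ‖f i‖) +
        2 * ε ^ 2 * ‖x‖ * ‖y‖ * (‖u‖ * ‖u‖) :=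
        norm_add_le_of_le (norm_sum_le_of_le _ fun i _ => h1 _ _) (h1 _ _)
    _ = _ := by rw [← Finset.mul_sum]; ring

end Newton

/-- One step of the Newton iteration towards a *-homomorphism. -/
theorem exists_newton_step (F : Type*) [NonUnitalCStarAlgebra F] [FiniteDimensional ℂ F]
    {K : ℝ} (hK0 : 0 ≤ K) :
    ∃ C : ℝ, 0 < C ∧ ∀ (A : Type*) [NonUnitalCStarAlgebra A] (φ : F →ₗ[ℂ] A) (ε : ℝ),
      (∀ x, φ (star x) = star (φ x)) → (∀ x, ‖φ x‖ ≤ K * ‖x‖) →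
      (∀ x y, ‖defect φ x y‖ ≤ ε * ‖x‖ * ‖y‖) →
      ∃ φ' : F →ₗ[ℂ] A, (∀ x, φ' (star x) = star (φ' x)) ∧
        (∀ x, ‖φ' x - φ x‖ ≤ C * ε * ‖x‖) ∧
        ∀ x y, ‖defect φ' x y‖ ≤ C * ε ^ 2 * ‖x‖ * ‖y‖ := by
  obtain ⟨d, e, f, u, hu1, hu2, -, hsum, hcas⟩ := exists_separability_idempotent F
  set N : ℝ := ∑ i, ‖e i‖ * ‖f i‖ + ‖u‖ * ‖u‖ with hN
  have hN0 : 0 ≤ N := by positivity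
  set c : ℝ := K * N + ‖u‖ with hc
  have hc0 : 0 ≤ c := by positivity
  refine ⟨2 * N + c ^ 2 + c + 1, by positivity, fun A _ φ ε hstar hK hd => ?_⟩
  set χ := correction e f u φ with hχ
  have hχ1 : ∀ x, ‖χ x‖ ≤ c * ε * ‖x‖ := norm_correction_le hK hd hK0
  -- The sign of ε follows from the defect bound once F contains a nonzero vector.
  have hε : ∀ x : F, 0 ≤ ε * ‖x‖ := fun x => by
    by_cases h : ‖x‖ = 0
    · simp [h]
    · have := (norm_nonneg _).trans (hd x x)
      exact nonneg_of_mul_nonneg_left this (lt_of_le_of_ne (norm_nonneg x) (Ne.symm h))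
  have hχ2 : ∀ x y, ‖defect φ x y - coboundary φ χ x y‖ ≤ 2 * N * ε ^ 2 * ‖x‖ * ‖y‖ :=
    norm_defect_sub_coboundary_le hu1 hu2 hsum hcas hd
  have hs2 : ∀ x y, ‖defect φ x y - coboundary φ (sharp χ) x y‖ ≤ 2 * N * ε ^ 2 * ‖x‖ * ‖y‖ := by
    intro x y
    rw [coboundary_sharp _ _ hstar, defect_star _ hstar, ← star_sub, norm_star]
    exact (hχ2 _ _).trans (by rw [norm_star, norm_star]; apply le_of_eq; ring)
  -- As φ preserves the involution, `sharp χ` solves the linearized equation as well as χ does; the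
  -- mean keeps the next map *-preserving.
  set η : F →ₗ[ℂ] A := (1 / 2 : ℂ) • (χ + sharp χ) with hη
  have hη1 : ∀ x, ‖η x‖ ≤ c * ε * ‖x‖ := by
    intro x
    have h1 := hχ1 x
    have h2 := hχ1 (star x)
    rw [norm_star] at h2
    calc ‖η x‖ ≤ 1 / 2 * (‖χ x‖ + ‖χ (star x)‖) := by
          rw [hη, LinearMap.smul_apply, norm_smul]
          simp only [LinearMap.add_apply, sharp_apply]
          refine mul_le_mul (by simp) ((norm_add_le _ _).trans (by rw [norm_star])) (norm_nonneg _)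
            (by norm_num)
      _ ≤ _ := by linarith
  refine ⟨φ + η, fun x => ?_, fun x => ?_, fun x y => ?_⟩
  · simp [hη, hstar, star_smul, add_comm]
  · rw [LinearMap.add_apply, add_sub_cancel_left]
    refine (hη1 x).trans ?_
    have := hε x
    rw [mul_assoc, mul_assoc]
    gcongr
    nlinarith
  · rw [defect_add, coboundary_average]
    have h3 : ‖η x * η y‖ ≤ c ^ 2 * ε ^ 2 * ‖x‖ * ‖y‖ := by
      calc _ ≤ ‖η x‖ * ‖η y‖ := norm_mul_le _ _
        _ ≤ (c * ε * ‖x‖) * (c * ε * ‖y‖) := by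
          gcongr
          exacts [(norm_nonneg _).trans (hη1 x), hη1 x, hη1 y]
        _ = _ := by ring
    have h4 : ‖(1 / 2 : ℂ) • ((defect φ x y - coboundary φ χ x y) +
        (defect φ x y - coboundary φ (sharp χ) x y))‖ ≤ 2 * N * ε ^ 2 * ‖x‖ * ‖y‖ := by
      rw [norm_smul]
      have := norm_add_le_of_le (hχ2 x y) (hs2 x y)
      calc _ ≤ 1 / 2 * (2 * N * ε ^ 2 * ‖x‖ * ‖y‖ + 2 * N * ε ^ 2 * ‖x‖ * ‖y‖) :=
            mul_le_mul (by simp) this (norm_nonneg _) (by norm_num)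
        _ = _ := by ring
    refine (norm_sub_le_of_le h4 h3).trans ?_
    have : 0 ≤ (c + 1) * (ε ^ 2 * ‖x‖ * ‖y‖) := by positivity
    linarith

/-- Dependent choice along a predicate indexed by the natural numbers. -/
theorem exists_seq_of_step {X : Type*} {P : ℕ → X → Prop} {Q : ℕ → X → X → Prop} {x₀ : X}
    (h0 : P 0 x₀) (hstep : ∀ n x, P n x → ∃ y, P (n + 1) y ∧ Q n x y) :
    ∃ s : ℕ → X, s 0 = x₀ ∧ (∀ n, P n (s n)) ∧ ∀ n, Q n (s n) (s (n + 1)) := by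
  choose g hg using hstep
  let t : ∀ n, {x // P n x} := fun n =>
    Nat.rec ⟨x₀, h0⟩ (fun n x => ⟨g n x.1 x.2, (hg n x.1 x.2).1⟩) n
  exact ⟨fun n => (t n).1, rfl, fun n => (t n).2, fun n => (hg n _ (t n).2).2⟩

/-- A *-preserving linear map that is nearly multiplicative is near a *-homomorphism. -/
theorem exists_starAlgHom_near_of_star (F : Type*) [NonUnitalCStarAlgebra F]
    [FiniteDimensional ℂ F] {K : ℝ} (hK0 : 0 ≤ K) :
    ∃ C δ : ℝ, 0 < C ∧ 0 < δ ∧ ∀ (A : Type*) [NonUnitalCStarAlgebra A] (φ : F →ₗ[ℂ] A) (ε : ℝ),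
      0 ≤ ε → ε ≤ δ → (∀ x, φ (star x) = star (φ x)) → (∀ x, ‖φ x‖ ≤ K * ‖x‖) →
      (∀ x y, ‖defect φ x y‖ ≤ ε * ‖x‖ * ‖y‖) →
      ∃ ψ : F →⋆ₙₐ[ℂ] A, ∀ x, ‖ψ x - φ x‖ ≤ C * ε * ‖x‖ := by
  -- For ε ≤ 1/(2C) a step takes defect ε/2ⁿ to at most ε/2ⁿ⁺¹, and the displacements add up to at
  -- most 2Cε ≤ 1; hence the one unit of room in the norm bound.
  obtain ⟨C, hC, hstep⟩ := exists_newton_step F (K := K + 1) (by positivity)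
  refine ⟨2 * C, 1 / (2 * C), by positivity, by positivity, fun A _ φ ε hε0 hε hs hK hd => ?_⟩
  have hCε : 2 * C * ε ≤ 1 := by
    rw [le_div_iff₀ (by positivity)] at hε; linarith
  obtain ⟨s, hs0, hP, hQ⟩ := exists_seq_of_step (x₀ := φ)
    (P := fun n χ => (∀ x, χ (star x) = star (χ x)) ∧
      (∀ x, ‖χ x - φ x‖ ≤ 2 * C * ε * (1 - (1 / 2) ^ n) * ‖x‖) ∧
      ∀ x y, ‖defect χ x y‖ ≤ (ε * (1 / 2) ^ n) * ‖x‖ * ‖y‖)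
    (Q := fun n χ χ' => ∀ x, ‖χ' x - χ x‖ ≤ C * (ε * (1 / 2) ^ n) * ‖x‖)
    ⟨hs, by simp, by simpa using hd⟩ (by
      rintro n χ ⟨h1, h2, h3⟩
      have hpow : (0 : ℝ) ≤ (1 / 2) ^ n := by positivity
      have hpow1 : ((1 : ℝ) / 2) ^ n ≤ 1 := pow_le_one₀ (by norm_num) (by norm_num)
      obtain ⟨χ', g1, g2, g3⟩ := hstep A χ (ε * (1 / 2) ^ n) h1 (fun x => by
        have e1 := norm_le_norm_add_norm_sub' (χ x) (φ x)
        have e2 : 2 * C * ε * (1 - (1 / 2) ^ n) * ‖x‖ ≤ 1 * ‖x‖ := by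
          gcongr
          nlinarith [mul_nonneg (mul_nonneg hC.le hε0) hpow]
        linarith [h2 x, hK x]) h3
      refine ⟨χ', ⟨g1, fun x => ?_, fun x y => (g3 x y).trans ?_⟩, g2⟩
      · calc ‖χ' x - φ x‖ ≤ ‖χ' x - χ x‖ + ‖χ x - φ x‖ := norm_sub_le_norm_sub_add_norm_sub _ _ _
          _ ≤ C * (ε * (1 / 2) ^ n) * ‖x‖ + 2 * C * ε * (1 - (1 / 2) ^ n) * ‖x‖ :=
            add_le_add (g2 x) (h2 x)
          _ = _ := by ring
      · gcongr ?_ * ‖x‖ * ‖y‖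
        calc C * (ε * (1 / 2) ^ n) ^ 2
            = (2 * C * ε) * ((1 / 2) ^ n) * (ε * ((1 / 2) ^ (n + 1))) := by ring
          _ ≤ 1 * 1 * (ε * ((1 / 2) ^ (n + 1))) := by gcongr
          _ = _ := by ring)
  have hdist : ∀ x n, dist (s n x) (s (n + 1) x) ≤ 2 * C * ε * ‖x‖ / 2 / 2 ^ n := fun x n => by
    rw [dist_comm, dist_eq_norm]
    refine (hQ n x).trans (le_of_eq ?_)
    rw [one_div, inv_pow]
    field_simp
  have hlim : ∀ x, ∃ a, Filter.Tendsto (fun n => s n x) Filter.atTop (nhds a) := fun x =>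
    cauchySeq_tendsto_of_complete (cauchySeq_of_le_geometric_two (hdist x))
  choose ψ hψ using hlim
  have hdef : ∀ x y, Filter.Tendsto (fun n => defect (s n) x y) Filter.atTop (nhds 0) := by
    intro x y
    refine squeeze_zero_norm (a := fun n => ε * (1 / 2) ^ n * ‖x‖ * ‖y‖)
      (fun n => (hP n).2.2 x y) ?_
    have := tendsto_pow_atTop_nhds_zero_of_lt_one (r := (1 / 2 : ℝ)) (by norm_num) (by norm_num)
    simpa using ((this.const_mul ε).mul_const ‖x‖).mul_const ‖y‖
  refine ⟨{ toFun := ψ, map_smul' := ?_, map_zero' := ?_, map_add' := ?_, map_mul' := ?_,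
            map_star' := ?_ }, fun x => ?_⟩
  · intro c x
    exact tendsto_nhds_unique (hψ _) (by simpa using (hψ x).const_smul c)
  · exact tendsto_nhds_unique (hψ 0) (by simp)
  · intro x y
    exact tendsto_nhds_unique (hψ _) (by simpa using (hψ x).add (hψ y))
  · intro x y
    refine tendsto_nhds_unique (hψ _) ?_
    simpa [defect_apply] using (hdef x y).add ((hψ x).mul (hψ y))
  · intro x
    exact tendsto_nhds_unique (hψ _) (by simpa [(hP _).1] using (hψ x).star)
  · have := dist_le_of_le_geometric_two_of_tendsto₀ (hdist x) (hψ x)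
    rw [hs0, dist_comm, dist_eq_norm] at this
    exact this

/-- A linear map that is nearly a *-homomorphism is near a *-homomorphism. -/
theorem exists_starAlgHom_near (F : Type*) [NonUnitalCStarAlgebra F]
    [FiniteDimensional ℂ F] {K : ℝ} (hK0 : 0 ≤ K) :
    ∃ C δ : ℝ, 0 < C ∧ 0 < δ ∧ ∀ (A : Type*) [NonUnitalCStarAlgebra A] (φ : F →ₗ[ℂ] A) (ε : ℝ),
      0 ≤ ε → ε ≤ δ → (∀ x, ‖φ (star x) - star (φ x)‖ ≤ ε * ‖x‖) → (∀ x, ‖φ x‖ ≤ K * ‖x‖) →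
      (∀ x y, ‖φ (x * y) - φ x * φ y‖ ≤ ε * ‖x‖ * ‖y‖) →
      ∃ ψ : F →⋆ₙₐ[ℂ] A, ∀ x, ‖ψ x - φ x‖ ≤ C * ε * ‖x‖ := by
  obtain ⟨C, δ, hC, hδ, h⟩ := exists_starAlgHom_near_of_star F hK0
  refine ⟨C * (2 * K + 3) + 1, δ / (2 * K + 3), by positivity, by positivity,
    fun A _ φ ε hε0 hε hs hK hd => ?_⟩
  have hε2 : (2 * K + 3) * ε ≤ δ := by
    rw [le_div_iff₀ (by positivity)] at hε; linarith
  -- `φ + χ` is the mean of φ and its adjoint. It keeps the bound K, and the defect grows by at most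
  -- the factor 2K + 3.
  set χ : F →ₗ[ℂ] A := (1 / 2 : ℂ) • (sharp φ - φ) with hχ
  have hχ1 : ∀ x, ‖χ x‖ ≤ ε * ‖x‖ := by
    intro x
    have : sharp φ x - φ x = star (φ (star x) - star (φ x)) := by simp
    rw [hχ, LinearMap.smul_apply, LinearMap.sub_apply, this, norm_smul, norm_star]
    calc _ ≤ 1 * ‖φ (star x) - star (φ x)‖ := by gcongr; norm_num
      _ ≤ _ := by rw [one_mul]; exact hs x
  have hadd : ∀ x, (φ + χ) x = (1 / 2 : ℂ) • (φ x + star (φ (star x))) := by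
    intro x
    simp only [hχ, LinearMap.add_apply, LinearMap.smul_apply, LinearMap.sub_apply, sharp_apply]
    module
  obtain ⟨ψ, hψ⟩ := h A (φ + χ) ((2 * K + 3) * ε) (by positivity) hε2 (fun x => by
      simp [hadd, star_smul, add_comm]) (fun x => by
      rw [hadd, norm_smul]
      have h1 := hK (star x)
      rw [norm_star] at h1
      have : ‖φ x + star (φ (star x))‖ ≤ K * ‖x‖ + K * ‖x‖ :=
        norm_add_le_of_le (hK x) (by rwa [norm_star])
      calc _ ≤ 1 / 2 * (K * ‖x‖ + K * ‖x‖) :=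
            mul_le_mul (by simp) this (norm_nonneg _) (by norm_num)
        _ = _ := by ring) (fun x y => by
      have e : defect (φ + χ) x y =
          defect φ x y + χ (x * y) - φ x * χ y - χ x * (φ + χ) y := by
        rw [defect_add]; simp only [coboundary, LinearMap.add_apply, mul_add]; abel
      have hx := norm_nonneg x
      have hy := norm_nonneg y
      have b1 : ‖χ (x * y)‖ ≤ ε * (‖x‖ * ‖y‖) := (hχ1 _).trans (by gcongr; exact norm_mul_le _ _)
      have b2 : ‖φ x * χ y‖ ≤ (K * ‖x‖) * (ε * ‖y‖) :=
        (norm_mul_le _ _).trans (by gcongr; exacts [hK x, hχ1 y])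
      have b3 : ‖χ x * (φ + χ) y‖ ≤ (ε * ‖x‖) * (K * ‖y‖) := by
        refine (norm_mul_le _ _).trans ?_
        have h1 := hK (star y)
        rw [norm_star] at h1
        have : ‖φ y + star (φ (star y))‖ ≤ K * ‖y‖ + K * ‖y‖ :=
          norm_add_le_of_le (hK y) (by rwa [norm_star])
        have : ‖(φ + χ) y‖ ≤ K * ‖y‖ := by
          rw [hadd, norm_smul]
          calc _ ≤ 1 / 2 * (K * ‖y‖ + K * ‖y‖) :=
                mul_le_mul (by simp) this (norm_nonneg _) (by norm_num)
            _ = _ := by ring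
        gcongr
        exact hχ1 x
      have b0 : ‖defect φ x y‖ ≤ ε * ‖x‖ * ‖y‖ := hd x y
      rw [e]
      refine (norm_sub_le_of_le (norm_sub_le_of_le (norm_add_le_of_le b0 b1) b2) b3).trans ?_
      have : 0 ≤ ε * (‖x‖ * ‖y‖) := by positivity
      nlinarith [mul_nonneg hK0 this])
  refine ⟨ψ, fun x => ?_⟩
  have h1 := hψ x
  have h2 := hχ1 x
  have h3 : ψ x - φ x = (ψ x - (φ + χ) x) + χ x := by
    rw [LinearMap.add_apply]; abel
  rw [h3]
  refine (norm_add_le_of_le h1 h2).trans (le_of_eq ?_)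
  ring

end CStarLogic

namespace CStarLogic

/-! ### Detecting scalar multiples of a projection by norms. -/

section Scalars

variable {A : Type*} [NonUnitalCStarAlgebra A]

/-- The quantity `‖z - z*‖ + ‖z - p z‖ + (‖p + z‖ + ‖p - z‖ - 2)⁺`, which controls the distance of
`z` to the real multiples of the projection `p`. -/
noncomputable def scalarDefect (p z : A) : ℝ :=
  ‖z - star z‖ + ‖z - p * z‖ + max (‖p + z‖ + ‖p - z‖ - 2) 0

theorem scalarDefect_nonneg (p z : A) : 0 ≤ scalarDefect p z := by
  unfold scalarDefect; positivity

theorem norm_le_one_of_projection {q : A} (hs : star q = q) (hq : q * q = q) : ‖q‖ ≤ 1 := by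
  have h := CStarRing.norm_star_mul_self (x := q)
  rw [hs, hq] at h
  by_contra! h1
  nlinarith

theorem scalarDefect_smul {q : A} (hs : star q = q) (hq : q * q = q) {t : ℝ} (ht : |t| ≤ 1) :
    scalarDefect q ((t : ℂ) • q) = 0 := by
  have h1 := norm_le_one_of_projection hs hq
  obtain ⟨h2, h3⟩ := abs_le.1 ht
  have e1 : ‖q + (t : ℂ) • q‖ = (1 + t) * ‖q‖ := by
    have : q + (t : ℂ) • q = ((1 + t : ℝ) : ℂ) • q := by push_cast; module
    rw [this, norm_smul, Complex.norm_real, Real.norm_of_nonneg (by linarith)]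
  have e2 : ‖q - (t : ℂ) • q‖ = (1 - t) * ‖q‖ := by
    have : q - (t : ℂ) • q = ((1 - t : ℝ) : ℂ) • q := by push_cast; module
    rw [this, norm_smul, Complex.norm_real, Real.norm_of_nonneg (by linarith)]
  have e3 : star ((t : ℂ) • q) = (t : ℂ) • q := by simp [star_smul, hs]
  rw [scalarDefect, e1, e2, e3, mul_smul_comm, hq, max_eq_right (by linarith)]
  simp

theorem scalarDefect_le_add (p q z : A) :
    scalarDefect q z ≤ scalarDefect p z + (‖z‖ + 2) * ‖p - q‖ := by
  have h1 : ‖z - q * z‖ ≤ ‖z - p * z‖ + ‖p - q‖ * ‖z‖ := by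
    have : z - q * z = (z - p * z) + (p - q) * z := by rw [sub_mul]; abel
    rw [this]
    exact norm_add_le_of_le le_rfl (norm_mul_le _ _)
  have h2 : ‖q + z‖ ≤ ‖p + z‖ + ‖p - q‖ := by
    have : q + z = (p + z) - (p - q) := by abel
    rw [this]; exact norm_sub_le _ _
  have h3 : ‖q - z‖ ≤ ‖p - z‖ + ‖p - q‖ := by
    have : q - z = (p - z) - (p - q) := by abel
    rw [this]; exact norm_sub_le _ _
  have h4 : max (‖q + z‖ + ‖q - z‖ - 2) 0 ≤ max (‖p + z‖ + ‖p - z‖ - 2) 0 + 2 * ‖p - q‖ :=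
    max_le (by linarith [le_max_left (‖p + z‖ + ‖p - z‖ - 2) 0])
      (by positivity)
  unfold scalarDefect
  linarith

/-- A self-adjoint element `h` of the corner of a projection `q` is near a multiple of `q`. -/
theorem exists_norm_sub_smul_le_of_corner {q h : A} (hs : star q = q) (hq : q * q = q)
    (hh : star h = h) (hqh : q * h * q = h) :
    ∃ t : ℝ, ‖h - (t : ℂ) • q‖ ≤ max (‖q + h‖ + ‖q - h‖ - 2) 0 := by
  let _ := CStarAlgebra.spectralOrder A
  have := CStarAlgebra.spectralOrderedRing A
  have hqqq : q * q * q = q := by rw [hq, hq]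
  -- Compress b ≤ ‖b‖ by q. This gives (1 - ‖q - h‖) q ≤ h ≤ (‖q + h‖ - 1) q, an interval of length
  -- ‖q + h‖ + ‖q - h‖ - 2.
  have key : ∀ b : A, star b = b → q * b * q = b → b ≤ ‖b‖ • q := fun b hb hqb => by
    have := CStarAlgebra.star_left_conjugate_le_norm_smul (a := q) (b := b) hb
    rwa [hs, hqb, hq] at this
  have hq0 : 0 ≤ q := by rw [← hq]; nth_rw 1 [← hs]; exact star_mul_self_nonneg q
  have k1 := key (q + h) (by rw [star_add, hs, hh]) (by rw [mul_add, add_mul, hqh, hqqq])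
  have k2 := key (q - h) (by rw [star_sub, hs, hh]) (by rw [mul_sub, sub_mul, hqh, hqqq])
  set M := ‖q + h‖
  set M' := ‖q - h‖
  refine ⟨1 - M', ?_⟩
  have e : h - ((1 - M' : ℝ) : ℂ) • q = M' • q - (q - h) := by
    have : M' • q = (M' : ℂ) • q := (RCLike.real_smul_eq_coe_smul (K := ℂ) M' q)
    rw [this]; push_cast; module
  have l1 : 0 ≤ h - ((1 - M' : ℝ) : ℂ) • q := by rw [e]; exact sub_nonneg.2 k2
  have l2 : h - ((1 - M' : ℝ) : ℂ) • q ≤ (max (M + M' - 2) 0) • q := by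
    calc h - ((1 - M' : ℝ) : ℂ) • q = (q + h) + (M' - 2) • q := by
          rw [e, sub_smul, two_smul]; abel
      _ ≤ M • q + (M' - 2) • q := by gcongr
      _ = (M + M' - 2) • q := by rw [← add_smul]; ring_nf
      _ ≤ _ := by gcongr; exact le_max_left _ _
  calc _ ≤ ‖(max (M + M' - 2) 0) • q‖ := CStarAlgebra.norm_le_norm_of_nonneg_of_le l1 l2
    _ ≤ max (M + M' - 2) 0 * 1 := by
      rw [norm_smul, Real.norm_of_nonneg (le_max_right _ _)]
      gcongr
      exact norm_le_one_of_projection hs hq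
    _ = _ := mul_one _

/-- The first two terms of `scalarDefect` bound the distance from z to a self-adjoint element of the
corner of q; the third then bounds the spread of that element. -/
theorem exists_norm_sub_smul_le {q : A} (hs : star q = q) (hq : q * q = q) (z : A) :
    ∃ t : ℝ, ‖z - (t : ℂ) • q‖ ≤ 12 * scalarDefect q z := by
  have hq1 := norm_le_one_of_projection hs hq
  set h := (1 / 2 : ℂ) • (q * (z + star z) * q) with hh
  set a := ‖z - star z‖ with ha
  set b := ‖z - q * z‖ with hb
  have hb' : ‖star z - star z * q‖ = b := by
    rw [hb, ← norm_star]; simp [hs]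
  have c1 : ‖z * q - z‖ ≤ 2 * a + b := by
    have : z * q - z = (z - star z) * q - (z - star z) - (star z - star z * q) := by
      rw [sub_mul]; abel
    rw [this]
    have h1 : ‖(z - star z) * q‖ ≤ a * 1 := (norm_mul_le _ _).trans (by gcongr)
    have := norm_sub_le_of_le (norm_sub_le_of_le h1 (le_refl ‖z - star z‖)) hb'.le
    linarith
  have c2 : ‖q * z * q - z‖ ≤ 2 * a + 2 * b := by
    have : q * z * q - z = (z * q - z) - (z - q * z) * q := by rw [sub_mul]; abel
    rw [this]
    have h1 : ‖(z - q * z) * q‖ ≤ b * 1 := (norm_mul_le _ _).trans (by gcongr)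
    have := norm_sub_le_of_le c1 h1
    linarith
  have c3 : ‖h - z‖ ≤ 5 / 2 * a + 2 * b := by
    have : h - z = (q * z * q - z) - (1 / 2 : ℂ) • (q * (z - star z) * q) := by
      rw [hh]; simp only [mul_add, add_mul, mul_sub, sub_mul]; module
    rw [this]
    have h1 : ‖(1 / 2 : ℂ) • (q * (z - star z) * q)‖ ≤ 1 / 2 * (1 * a * 1) := by
      rw [norm_smul]
      refine mul_le_mul (by simp) ?_ (norm_nonneg _) (by norm_num)
      refine (norm_mul_le _ _).trans ?_
      gcongr
      refine (norm_mul_le _ _).trans ?_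
      gcongr
    have := norm_sub_le_of_le c2 h1
    linarith
  obtain ⟨t, ht⟩ := exists_norm_sub_smul_le_of_corner (h := h) hs hq
    (by simp [hh, star_smul, hs, mul_assoc, add_comm])
    (by
      rw [hh, mul_smul_comm, smul_mul_assoc]
      congr 1
      rw [mul_assoc q, mul_assoc _ q q, hq, ← mul_assoc, ← mul_assoc, hq])
  refine ⟨t, ?_⟩
  have d1 : ‖q + h‖ ≤ ‖q + z‖ + ‖h - z‖ := by
    have : q + h = (q + z) + (h - z) := by abel
    rw [this]; exact norm_add_le _ _
  have d2 : ‖q - h‖ ≤ ‖q - z‖ + ‖h - z‖ := by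
    have : q - h = (q - z) - (h - z) := by abel
    rw [this]; exact norm_sub_le _ _
  have d3 : ‖z - (t : ℂ) • q‖ ≤ ‖h - z‖ + ‖h - (t : ℂ) • q‖ := by
    have : z - (t : ℂ) • q = (h - (t : ℂ) • q) - (h - z) := by abel
    rw [this, add_comm]; exact norm_sub_le _ _
  have d4 : max (‖q + h‖ + ‖q - h‖ - 2) 0 ≤
      max (‖q + z‖ + ‖q - z‖ - 2) 0 + 2 * ‖h - z‖ :=
    max_le (by linarith [le_max_left (‖q + z‖ + ‖q - z‖ - 2) 0])
      (by positivity)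
  have d5 : 0 ≤ max (‖q + z‖ + ‖q - z‖ - 2) 0 := le_max_right _ _
  have ha0 : 0 ≤ a := norm_nonneg _
  have hb0 : 0 ≤ b := norm_nonneg _
  unfold scalarDefect
  linarith

end Scalars

end CStarLogic

namespace CStarLogic

/-! ### Elementary bounds for the distance to the copies. -/

section CopyDist

variable {F A : Type*} [NonUnitalCStarAlgebra F] [NonUnitalCStarAlgebra A] {n : ℕ}

theorem bddBelow_copyDist (a : Fin n → A) :
    BddBelow (insert 1 {r : ℝ | ∃ φ : F →⋆ₙₐ[ℂ] A, Function.Injective φ ∧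
      r = ⨆ i : Fin n, Metric.infDist (a i) (Set.range φ)}) := by
  refine ⟨0, ?_⟩
  rintro r (rfl | ⟨φ, -, rfl⟩)
  · exact zero_le_one
  · exact Real.iSup_nonneg fun i => Metric.infDist_nonneg

theorem copyDist_le_one (a : Fin n → A) : copyDist F a ≤ 1 :=
  csInf_le (bddBelow_copyDist a) (Set.mem_insert _ _)

theorem copyDist_le_of_injective (a : Fin n → A) {φ : F →⋆ₙₐ[ℂ] A} (hφ : Function.Injective φ)
    {r : ℝ} (hr : 0 ≤ r) (h : ∀ i, ∃ y, ‖a i - φ y‖ ≤ r) : copyDist F a ≤ r := by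
  refine (csInf_le (bddBelow_copyDist a) (Set.mem_insert_of_mem _ ⟨φ, hφ, rfl⟩)).trans ?_
  -- `0 ≤ r` covers n = 0, where the real supremum is 0.
  refine Real.iSup_le (fun i => ?_) hr
  obtain ⟨y, hy⟩ := h i
  rw [← dist_eq_norm] at hy
  exact (Metric.infDist_le_dist_of_mem (Set.mem_range_self y)).trans hy

end CopyDist

/-! ### Stability of the relations, and the exact penalty function. -/

section Gauge

variable {F A ι : Type*} [NonUnitalCStarAlgebra F] [NonUnitalCStarAlgebra A] [Fintype ι]

/-- How far the tuple `x` is from being the image of the basis `b` under a *-homomorphism that is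
bounded below by `1 / 2` on the finite set `N`. -/
noncomputable def relDefect (b : Module.Basis ι ℂ F) (N : Finset F) (x : ι → A) : ℝ :=
  ∑ j, ∑ k, ‖x j * x k - b.constr ℂ x (b j * b k)‖ + ∑ j, ‖star (x j) - b.constr ℂ x (star (b j))‖ +
    ∑ v ∈ N, max (1 - 2 * ‖b.constr ℂ x v‖) 0

theorem relDefect_nonneg (b : Module.Basis ι ℂ F) (N : Finset F) (x : ι → A) :
    0 ≤ relDefect b N x := by
  unfold relDefect; positivity

theorem constr_comp_basis (b : Module.Basis ι ℂ F) (φ : F →⋆ₙₐ[ℂ] A) (v : F) :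
    b.constr ℂ (fun j => φ (b j)) v = φ v := by
  rw [Module.Basis.constr_apply_fintype]
  conv_rhs => rw [← b.sum_equivFun v]
  simp only [map_sum, map_smul]

theorem relDefect_comp_eq_zero (b : Module.Basis ι ℂ F) {N : Finset F} (hN : ∀ v ∈ N, ‖v‖ = 1)
    {φ : F →⋆ₙₐ[ℂ] A} (hφ : Function.Injective φ) : relDefect b N (fun j => φ (b j)) = 0 := by
  simp only [relDefect, constr_comp_basis, map_mul, map_star, sub_self, norm_zero,
    Finset.sum_const_zero, zero_add]
  refine Finset.sum_eq_zero fun v hv => ?_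
  rw [NonUnitalStarAlgHom.norm_map φ hφ, hN v hv]
  norm_num

theorem norm_constr_le (b : Module.Basis ι ℂ F) {y : ι → A} {B : ℝ} (hy : ∀ j, ‖y j‖ ≤ B) (v : F) :
    ‖b.constr ℂ y v‖ ≤ (∑ j, ‖b.equivFun v j‖) * B := by
  rw [Module.Basis.constr_apply_fintype, Finset.sum_mul]
  exact norm_sum_le_of_le _ fun j _ => by rw [norm_smul]; gcongr; exact hy j

variable [FiniteDimensional ℂ F]

theorem exists_norm_equivFun_le (b : Module.Basis ι ℂ F) :
    ∃ s : ℝ, 0 < s ∧ ∀ v, ∑ j, ‖b.equivFun v j‖ ≤ s * ‖v‖ := by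
  let f : F →L[ℂ] (ι → ℂ) := LinearMap.toContinuousLinearMap b.equivFun.toLinearMap
  refine ⟨Fintype.card ι * ‖f‖ + 1, by positivity, fun v => ?_⟩
  calc ∑ j, ‖b.equivFun v j‖ ≤ ∑ j : ι, ‖f‖ * ‖v‖ :=
        Finset.sum_le_sum fun j _ => (norm_le_pi_norm (f v) j).trans (f.le_opNorm v)
    _ = Fintype.card ι * ‖f‖ * ‖v‖ := by simp [mul_assoc]
    _ ≤ _ := by gcongr; linarith

/-- Weak stability of the relations that define the copies of `F`. -/
theorem exists_injective_starAlgHom_near (b : Module.Basis ι ℂ F) {N : Finset F}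
    (hN : ∀ v : F, ‖v‖ = 1 → ∃ e ∈ N, ‖v - e‖ < 1 / 4) {K : ℝ} (hK0 : 0 ≤ K) :
    ∃ C δ : ℝ, 0 < C ∧ 0 < δ ∧ ∀ (A : Type*) [NonUnitalCStarAlgebra A] (x : ι → A),
      (∀ j, ‖x j‖ ≤ K) → relDefect b N x ≤ δ →
      ∃ ψ : F →⋆ₙₐ[ℂ] A, Function.Injective ψ ∧ ∀ j, ‖ψ (b j) - x j‖ ≤ C * relDefect b N x := by
  obtain ⟨s, hs, hsv⟩ := exists_norm_equivFun_le b
  obtain ⟨C, δ, hC, hδ, h⟩ := exists_starAlgHom_near F (K := s * K) (by positivity)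
  set R : ℝ := ∑ e ∈ N, ‖e‖ with hR
  set T : ℝ := ∑ j, ‖b j‖ with hT
  -- Passing from basis vectors to all of F costs s² for products and s for adjoints. The second
  -- bound in the minimum serves injectivity.
  refine ⟨C * (s ^ 2 + s) * (T + 1), min (δ / (s ^ 2 + s)) (1 / (4 + 16 * (C * (s ^ 2 + s) * R))),
    by positivity, by positivity, fun A _ x hx hP => ?_⟩
  set P := relDefect b N x with hPdef
  have hP0 : 0 ≤ P := relDefect_nonneg b N x
  have hP1 : (s ^ 2 + s) * P ≤ δ := by
    have := hP.trans (min_le_left _ _)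
    rw [le_div_iff₀ (by positivity)] at this; linarith
  have hP2 : P * (4 + 16 * (C * (s ^ 2 + s) * R)) ≤ 1 := by
    have := hP.trans (min_le_right _ _)
    rwa [le_div_iff₀ (by positivity)] at this
  set φ := b.constr ℂ x with hφ
  have hφv : ∀ v, φ v = ∑ j, b.equivFun v j • x j := fun v => b.constr_apply_fintype ℂ x v
  have s1 : ∑ j, ∑ k, ‖x j * x k - φ (b j * b k)‖ ≤ P := by
    have h1 : 0 ≤ ∑ j, ‖star (x j) - φ (star (b j))‖ := by positivity
    have h2 : 0 ≤ ∑ v ∈ N, max (1 - 2 * ‖φ v‖) 0 := by positivity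
    rw [hPdef, relDefect]; linarith
  have s2 : ∑ j, ‖star (x j) - φ (star (b j))‖ ≤ P := by
    have h1 : 0 ≤ ∑ j, ∑ k, ‖x j * x k - φ (b j * b k)‖ := by positivity
    have h2 : 0 ≤ ∑ v ∈ N, max (1 - 2 * ‖φ v‖) 0 := by positivity
    rw [hPdef, relDefect]; linarith
  have s3 : ∀ v ∈ N, 1 - 2 * ‖φ v‖ ≤ P := by
    intro v hv
    have h1 : 0 ≤ ∑ j, ∑ k, ‖x j * x k - φ (b j * b k)‖ := by positivity
    have h2 : 0 ≤ ∑ j, ‖star (x j) - φ (star (b j))‖ := by positivity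
    have h3 := Finset.single_le_sum (f := fun v => max (1 - 2 * ‖φ v‖) 0)
      (fun v _ => le_max_right _ _) hv
    have h4 := le_max_left (1 - 2 * ‖φ v‖) 0
    rw [hPdef, relDefect]
    linarith
  have hcoord : ∀ v j, ‖b.equivFun v j‖ ≤ s * ‖v‖ := fun v j =>
    (Finset.single_le_sum (f := fun j => ‖b.equivFun v j‖) (fun j _ => norm_nonneg _)
      (Finset.mem_univ j)).trans (hsv v)
  have hs2 : 0 ≤ s ^ 2 := by positivity
  obtain ⟨ψ, hψ⟩ := h A φ ((s ^ 2 + s) * P) (by positivity) hP1 (fun v => by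
    have e : φ (star v) - star (φ v) =
        ∑ j, star (b.equivFun v j) • (φ (star (b j)) - star (x j)) := by
      have : star v = ∑ j, star (b.equivFun v j) • star (b j) := by
        have := congrArg star (b.sum_equivFun v)
        rw [star_sum] at this
        simpa only [star_smul] using this.symm
      rw [this, hφv v, star_sum, map_sum, ← Finset.sum_sub_distrib]
      simp only [map_smul, star_smul, smul_sub]
    rw [e]
    calc _ ≤ ∑ j, (s * ‖v‖) * ‖star (x j) - φ (star (b j))‖ :=
          norm_sum_le_of_le _ fun j _ => by
            rw [norm_smul, norm_star, norm_sub_rev]; gcongr; exact hcoord v j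
      _ ≤ (s * ‖v‖) * P := by rw [← Finset.mul_sum]; gcongr
      _ ≤ _ := by nlinarith [mul_nonneg hs2 (mul_nonneg hP0 (norm_nonneg v))])
    (fun v => (norm_constr_le b hx v).trans (by
      calc _ ≤ s * ‖v‖ * K := by gcongr; exact hsv v
        _ = _ := by ring)) (fun v w => by
    have e : φ (v * w) - φ v * φ w = ∑ j, ∑ k,
        (b.equivFun v j * b.equivFun w k) • (φ (b j * b k) - x j * x k) := by
      have : v * w = ∑ j, ∑ k, (b.equivFun v j * b.equivFun w k) • (b j * b k) := by
        have := congrArg₂ (· * ·) (b.sum_equivFun v) (b.sum_equivFun w)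
        simp only [Finset.sum_mul_sum, smul_mul_smul_comm] at this
        exact this.symm
      rw [this, hφv v, hφv w, Finset.sum_mul, map_sum, ← Finset.sum_sub_distrib]
      refine Finset.sum_congr rfl fun j _ => ?_
      rw [Finset.mul_sum, map_sum, ← Finset.sum_sub_distrib]
      refine Finset.sum_congr rfl fun k _ => ?_
      rw [map_smul, smul_sub, smul_mul_assoc, mul_smul_comm, smul_smul]
    rw [e]
    calc _ ≤ ∑ j, ∑ k, (s * ‖v‖) * (s * ‖w‖) * ‖x j * x k - φ (b j * b k)‖ :=
          norm_sum_le_of_le _ fun j _ => norm_sum_le_of_le _ fun k _ => by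
            rw [norm_smul, norm_mul, norm_sub_rev]
            gcongr
            exacts [hcoord v j, hcoord w k]
      _ ≤ (s * ‖v‖) * (s * ‖w‖) * P := by simp only [← Finset.mul_sum]; gcongr
      _ ≤ _ := by
        nlinarith [mul_nonneg hs.le (mul_nonneg hP0 (mul_nonneg (norm_nonneg v) (norm_nonneg w)))])
  refine ⟨ψ, ?_, fun j => ?_⟩
  -- A unit vector in the kernel has a net vector e within 1/4, so ‖ψ e‖ < 1/4; but ‖φ e‖ ≥ (1 -
  -- P)/2 and ψ is close to φ.
  · rw [injective_iff_map_eq_zero]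
    intro v hv
    by_contra hv0
    have hv1 : ‖v‖ ≠ 0 := norm_ne_zero_iff.2 hv0
    set w : F := ((‖v‖⁻¹ : ℝ) : ℂ) • v with hw
    have hw1 : ‖w‖ = 1 := by
      rw [hw, norm_smul, Complex.norm_real, norm_inv, norm_norm, inv_mul_cancel₀ hv1]
    obtain ⟨e, he, hwe⟩ := hN w hw1
    have h1 : ‖ψ e‖ < 1 / 4 := by
      have : ψ e = ψ (e - w) := by rw [map_sub, hw, map_smul, hv, smul_zero, sub_zero]
      rw [this]
      exact (NonUnitalStarAlgHom.norm_apply_le ψ _).trans_lt (by rwa [norm_sub_rev])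
    have h2 := hψ e
    have h3 := s3 e he
    have h4 := norm_le_norm_add_norm_sub (ψ e) (φ e)
    have h5 : ‖e‖ ≤ R := Finset.single_le_sum (fun v _ => norm_nonneg v) he
    have h6 : C * ((s ^ 2 + s) * P) * ‖e‖ ≤ C * ((s ^ 2 + s) * P) * R := by gcongr
    have h7 : 0 ≤ C * ((s ^ 2 + s) * P) * R := by positivity
    have h8 : P * (4 + 16 * (C * (s ^ 2 + s) * R)) = 4 * P + 16 * (C * ((s ^ 2 + s) * P) * R) := by
      ring
    linarith
  · have h5 : ‖b j‖ ≤ T := Finset.single_le_sum (f := fun j => ‖b j‖) (fun v _ => norm_nonneg _)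
      (Finset.mem_univ j)
    have : φ (b j) = x j := b.constr_basis ℂ x j
    rw [← this]
    calc _ ≤ C * ((s ^ 2 + s) * P) * ‖b j‖ := hψ _
      _ ≤ C * ((s ^ 2 + s) * P) * (T + 1) := by gcongr; linarith
      _ = _ := by ring

/-- The quantity whose infimum over `x`, `z`, `w` is the distance of `a` to the copies of `F`. -/
noncomputable def gauge (b : Module.Basis ι ℂ F) (N : Finset F) (u : F) (L C₁ C₂ : ℝ) {n : ℕ}
    (a : Fin n → A) (x : ι → A) (z w : Fin n → ι → A) : ℝ :=
  (⨆ i, ‖a i - ∑ k, (L : ℂ) • ((z i k + Complex.I • w i k) * x k)‖) + C₁ * relDefect b N x +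
    C₂ * ∑ i, ∑ k, (scalarDefect (b.constr ℂ x u) (z i k) + scalarDefect (b.constr ℂ x u) (w i k))

omit [FiniteDimensional ℂ F] in
theorem star_map_eq_and_mul_self {u : F} (hu : ∀ x, u * x = x) (hsu : star u = u)
    (φ : F →⋆ₙₐ[ℂ] A) : star (φ u) = φ u ∧ φ u * φ u = φ u :=
  ⟨by rw [← map_star, hsu], by rw [← map_mul, hu]⟩

/-- On data from a true copy both penalties vanish, whatever C₁ and C₂. The factor L brings the
coefficients into [-1, 1], where `scalarDefect` is zero. -/
theorem exists_gauge_le (b : Module.Basis ι ℂ F) {N : Finset F} (hN : ∀ v ∈ N, ‖v‖ = 1) {u : F}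
    (hu : ∀ x, u * x = x) (hsu : star u = u) {K : ℝ} (hK1 : 1 ≤ K) (hK : ∀ j, ‖b j‖ ≤ K) :
    ∃ L : ℝ, 0 < L ∧ ∀ (C₁ C₂ : ℝ) (A : Type*) [NonUnitalCStarAlgebra A] (n : ℕ) (a : Fin n → A),
      (∀ i, ‖a i‖ ≤ 1) → ∀ (φ : F →⋆ₙₐ[ℂ] A), Function.Injective φ → ∀ r : ℝ, r ≤ 2 →
      (∀ i, Metric.infDist (a i) (Set.range φ) < r) → 0 ≤ r →
      ∃ (x : ι → A) (z w : Fin n → ι → A), (∀ j, ‖x j‖ ≤ K) ∧ (∀ i k, ‖z i k‖ ≤ K) ∧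
        (∀ i k, ‖w i k‖ ≤ K) ∧ gauge b N u L C₁ C₂ a x z w ≤ r := by
  obtain ⟨s, hs, hsv⟩ := exists_norm_equivFun_le b
  -- ‖a i‖ ≤ 1 and r ≤ 2 give ‖y i‖ ≤ 3, because an injective *-homomorphism is isometric.
  refine ⟨3 * s, by positivity, fun C₁ C₂ A _ n a ha φ hφ r hr hdist hr0 => ?_⟩
  have hy : ∀ i, ∃ y, ‖a i - φ y‖ < r := fun i => by
    obtain ⟨-, ⟨y, rfl⟩, hy⟩ := (Metric.infDist_lt_iff (Set.range_nonempty φ)).1 (hdist i)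
    exact ⟨y, by rwa [dist_eq_norm] at hy⟩
  choose y hy using hy
  have hyn : ∀ i, ‖y i‖ ≤ 3 := fun i => by
    rw [← NonUnitalStarAlgHom.norm_map φ hφ]
    have := norm_le_norm_add_norm_sub (a i) (φ (y i))
    linarith [ha i, hy i]
  have hcoord : ∀ i j, ‖b.equivFun (y i) j‖ ≤ 3 * s := fun i j =>
    ((Finset.single_le_sum (f := fun j => ‖b.equivFun (y i) j‖) (fun j _ => norm_nonneg _)
      (Finset.mem_univ j)).trans (hsv _)).trans (by nlinarith [hyn i])
  obtain ⟨hq1, hq2⟩ := star_map_eq_and_mul_self hu hsu φ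
  have hqn := norm_le_one_of_projection hq1 hq2
  have ht : ∀ t : ℝ, |t| ≤ 3 * s → |t / (3 * s)| ≤ 1 := fun t ht => by
    rw [abs_div, abs_of_pos (by positivity : 0 < 3 * s), div_le_one (by positivity)]
    exact ht
  have hre : ∀ i j, |(b.equivFun (y i) j).re / (3 * s)| ≤ 1 := fun i j =>
    ht _ ((Complex.abs_re_le_norm _).trans (hcoord i j))
  have him : ∀ i j, |(b.equivFun (y i) j).im / (3 * s)| ≤ 1 := fun i j =>
    ht _ ((Complex.abs_im_le_norm _).trans (hcoord i j))
  have hnorm : ∀ t : ℝ, |t| ≤ 1 → ‖(t : ℂ) • φ u‖ ≤ K := fun t ht => by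
    rw [norm_smul, Complex.norm_real, Real.norm_eq_abs]
    nlinarith [abs_nonneg t, norm_nonneg (φ u)]
  refine ⟨fun j => φ (b j), fun i k => (((b.equivFun (y i) k).re / (3 * s) : ℝ) : ℂ) • φ u,
    fun i k => (((b.equivFun (y i) k).im / (3 * s) : ℝ) : ℂ) • φ u,
    fun j => (NonUnitalStarAlgHom.norm_apply_le φ _).trans (hK j),
    fun i k => hnorm _ (hre i k), fun i k => hnorm _ (him i k), ?_⟩
  rw [gauge, relDefect_comp_eq_zero b hN hφ, constr_comp_basis]
  simp only [scalarDefect_smul hq1 hq2 (hre _ _), scalarDefect_smul hq1 hq2 (him _ _),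
    add_zero, Finset.sum_const_zero, mul_zero]
  refine Real.iSup_le (fun i => ?_) hr0
  have hsum : ∑ k, ((3 * s : ℝ) : ℂ) • (((((b.equivFun (y i) k).re / (3 * s) : ℝ) : ℂ) • φ u +
      Complex.I • (((b.equivFun (y i) k).im / (3 * s) : ℝ) : ℂ) • φ u) * φ (b k)) = φ (y i) := by
    conv_rhs => rw [← b.sum_equivFun (y i), map_sum]
    refine Finset.sum_congr rfl fun k _ => ?_
    rw [smul_smul, ← add_smul, smul_mul_assoc, ← map_mul, hu, smul_smul, map_smul]
    congr 1
    have h3 : ((3 * s : ℝ) : ℂ) ≠ 0 := by exact_mod_cast (by positivity : (3 * s) ≠ 0)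
    conv_rhs => rw [← Complex.re_add_im (b.equivFun (y i) k)]
    rw [Complex.ofReal_div, Complex.ofReal_div]
    field_simp
  rw [hsum]
  exact (hy i).le

/-- If `relDefect` exceeds δ, its penalty alone is at least 1. Otherwise a true copy is near x, and
the coefficients read off from z and w give an error linear in the defects, uniformly in A and n,
which C₁ and C₂ absorb. -/
theorem exists_copyDist_le_gauge (b : Module.Basis ι ℂ F) {N : Finset F}
    (hN : ∀ v : F, ‖v‖ = 1 → ∃ e ∈ N, ‖v - e‖ < 1 / 4) {u : F}
    (hu : ∀ x, u * x = x) (hsu : star u = u) {K : ℝ} (hK1 : 1 ≤ K) (hK : ∀ j, ‖b j‖ ≤ K) {L : ℝ}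
    (hL : 0 < L) :
    ∃ C₁ C₂ : ℝ, 0 ≤ C₁ ∧ 0 ≤ C₂ ∧ ∀ (A : Type*) [NonUnitalCStarAlgebra A] (n : ℕ) (a : Fin n → A)
      (x : ι → A) (z w : Fin n → ι → A), (∀ j, ‖x j‖ ≤ K) → (∀ i k, ‖z i k‖ ≤ K) →
        (∀ i k, ‖w i k‖ ≤ K) → copyDist F a ≤ gauge b N u L C₁ C₂ a x z w := by
  obtain ⟨C, δ, hC, hδ, h⟩ := exists_injective_starAlgHom_near b hN (K := K) (by linarith)
  set U : ℝ := ∑ j, ‖b.equivFun u j‖ with hU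
  have hU0 : 0 ≤ U := by positivity
  have hK0 : 0 < K := by linarith
  -- The first summand pays for replacing `x k` by `ψ (b k)`, the second for replacing p by the
  -- projection `ψ u` in two scalar defects.
  set D : ℝ := 2 * K * C + 24 * K * (K + 2) * U * C with hD
  refine ⟨L * (Fintype.card ι * D) + 1 / δ, L * (12 * K), by positivity, by positivity,
    fun A _ n a x z w hx hz hw => ?_⟩
  set P := relDefect b N x with hPdef
  set p := b.constr ℂ x u with hp
  have hP0 : 0 ≤ P := relDefect_nonneg b N x
  set S := ∑ i, ∑ k, (scalarDefect p (z i k) + scalarDefect p (w i k)) with hS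
  have hSnn : ∀ i k, 0 ≤ scalarDefect p (z i k) + scalarDefect p (w i k) := fun i k =>
    add_nonneg (scalarDefect_nonneg _ _) (scalarDefect_nonneg _ _)
  have hS0 : 0 ≤ S := Finset.sum_nonneg fun i _ => Finset.sum_nonneg fun k _ => hSnn i k
  set M := ⨆ i, ‖a i - ∑ k, (L : ℂ) • ((z i k + Complex.I • w i k) * x k)‖ with hM
  have hM0 : 0 ≤ M := Real.iSup_nonneg fun i => norm_nonneg _
  have hg : gauge b N u L (L * (Fintype.card ι * D) + 1 / δ) (L * (12 * K)) a x z w =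
    M + (L * (Fintype.card ι * D) + 1 / δ) * P + L * (12 * K) * S := rfl
  rw [hg]
  by_cases hPδ : P ≤ δ
  swap
  · refine (copyDist_le_one a).trans ?_
    have h1 : 1 ≤ 1 / δ * P := by
      rw [one_div_mul_eq_div, one_le_div hδ]; exact (not_le.1 hPδ).le
    have h2 : 0 ≤ L * (Fintype.card ι * D) * P := by positivity
    have h3 : 0 ≤ L * (12 * K) * S := by positivity
    linarith
  obtain ⟨ψ, hinj, hψ⟩ := h A x hx hPδ
  obtain ⟨hq1, hq2⟩ := star_map_eq_and_mul_self hu hsu ψ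
  have hpq : ‖p - ψ u‖ ≤ U * (C * P) := by
    have : p - ψ u = b.constr ℂ (fun j => x j - ψ (b j)) u := by
      rw [hp, ← constr_comp_basis b ψ u]
      simp [Module.Basis.constr_apply_fintype, smul_sub]
    rw [this]
    exact norm_constr_le b (fun j => by rw [norm_sub_rev]; exact hψ j) u
  have hsc : ∀ z : A, ‖z‖ ≤ K →
      ∃ t : ℝ, ‖z - (t : ℂ) • ψ u‖ ≤ 12 * (scalarDefect p z + (K + 2) * (U * (C * P))) := by
    intro z hz
    obtain ⟨t, ht⟩ := exists_norm_sub_smul_le hq1 hq2 z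
    refine ⟨t, ht.trans ?_⟩
    have := scalarDefect_le_add p (ψ u) z
    gcongr
    refine this.trans ?_
    gcongr
  choose t ht using fun i k => hsc (z i k) (hz i k)
  choose t' ht' using fun i k => hsc (w i k) (hw i k)
  have hterm : ∀ i k, ‖(L : ℂ) • ((z i k + Complex.I • w i k) * x k) -
      ψ (((L : ℂ) * (t i k + Complex.I * t' i k)) • b k)‖ ≤
      L * (12 * K * (scalarDefect p (z i k) + scalarDefect p (w i k)) + D * P) := by
    intro i k
    have e : (L : ℂ) • ((z i k + Complex.I • w i k) * x k) -
        ψ (((L : ℂ) * (t i k + Complex.I * t' i k)) • b k) =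
        (L : ℂ) • ((z i k + Complex.I • w i k) * (x k - ψ (b k)) +
          ((z i k - (t i k : ℂ) • ψ u) + Complex.I • (w i k - (t' i k : ℂ) • ψ u)) * ψ (b k)) := by
      have hk : ψ u * ψ (b k) = ψ (b k) := by rw [← map_mul, hu]
      simp only [map_smul, mul_sub, add_mul, sub_mul, smul_mul_assoc, hk, smul_sub]
      module
    rw [e, norm_smul, Complex.norm_real, Real.norm_of_nonneg hL.le]
    have n1 : ‖z i k + Complex.I • w i k‖ ≤ 2 * K := by
      refine (norm_add_le_of_le (hz i k) (?_ : _ ≤ K)).trans (by linarith)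
      rw [norm_smul, Complex.norm_I, one_mul]; exact hw i k
    have n2 : ‖(z i k - (t i k : ℂ) • ψ u) + Complex.I • (w i k - (t' i k : ℂ) • ψ u)‖ ≤
        12 * (scalarDefect p (z i k) + (K + 2) * (U * (C * P))) +
        12 * (scalarDefect p (w i k) + (K + 2) * (U * (C * P))) := by
      refine norm_add_le_of_le (ht i k) ?_
      rw [norm_smul, Complex.norm_I, one_mul]; exact ht' i k
    have n3 : ‖x k - ψ (b k)‖ ≤ C * P := by rw [norm_sub_rev]; exact hψ k
    have n4 : ‖ψ (b k)‖ ≤ K := (NonUnitalStarAlgHom.norm_apply_le ψ _).trans (hK k)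
    have m1 := (norm_mul_le (z i k + Complex.I • w i k) (x k - ψ (b k))).trans
      (mul_le_mul n1 n3 (norm_nonneg _) (by positivity))
    have m2 := (norm_mul_le ((z i k - (t i k : ℂ) • ψ u) +
      Complex.I • (w i k - (t' i k : ℂ) • ψ u)) (ψ (b k))).trans
      (mul_le_mul n2 n4 (norm_nonneg _) ((norm_nonneg _).trans n2))
    gcongr
    refine (norm_add_le_of_le m1 m2).trans (le_of_eq ?_)
    rw [hD]; ring
  refine (copyDist_le_of_injective (φ := ψ) a hinj (r := M + L * (12 * K) * S +
    L * (Fintype.card ι * D) * P) (by positivity) (fun i =>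
    ⟨∑ k, ((L : ℂ) * (t i k + Complex.I * t' i k)) • b k, ?_⟩)).trans ?_
  · have h1 : ‖a i - ∑ k, (L : ℂ) • ((z i k + Complex.I • w i k) * x k)‖ ≤ M :=
      le_ciSup (f := fun i => ‖a i - ∑ k, (L : ℂ) • ((z i k + Complex.I • w i k) * x k)‖)
        (Set.finite_range _).bddAbove i
    have h2 : ‖∑ k, (L : ℂ) • ((z i k + Complex.I • w i k) * x k) -
        ψ (∑ k, ((L : ℂ) * (t i k + Complex.I * t' i k)) • b k)‖ ≤
        L * (12 * K) * S + L * (Fintype.card ι * D) * P := by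
      rw [map_sum, ← Finset.sum_sub_distrib]
      refine (norm_sum_le_of_le _ fun k _ => hterm i k).trans ?_
      rw [← Finset.mul_sum, Finset.sum_add_distrib, ← Finset.mul_sum, Finset.sum_const,
        Finset.card_univ, nsmul_eq_mul]
      have : ∑ k, (scalarDefect p (z i k) + scalarDefect p (w i k)) ≤ S :=
        Finset.single_le_sum (f := fun i => ∑ k, (scalarDefect p (z i k) + scalarDefect p (w i k)))
          (fun i _ => Finset.sum_nonneg fun k _ => hSnn i k) (Finset.mem_univ i)
      calc _ ≤ L * (12 * K * S + Fintype.card ι * (D * P)) := by gcongr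
        _ = _ := by ring
    have := (norm_sub_le_norm_sub_add_norm_sub _ _ _).trans (add_le_add h1 h2)
    linarith
  · have : 0 ≤ 1 / δ * P := by positivity
    linarith

end Gauge

end CStarLogic

namespace CStarLogic

/-! ### Closure properties of terms and formulas. -/

section Definable

variable {m n : ℕ}

/-- A family of operations on all C*-algebras that is given by a term. -/
def IsTermDefinable (t : ∀ (A : Type u) [NonUnitalCStarAlgebra A], (Fin m → A) → A) : Prop :=
  ∃ s : Term m, ∀ (A : Type u) [NonUnitalCStarAlgebra A] (a : Fin m → A), s.eval a = t A a

/-- A family of real functions on all C*-algebras that is given by a formula. -/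
def IsDefinable (g : ∀ (A : Type u) [NonUnitalCStarAlgebra A], (Fin m → A) → ℝ) : Prop :=
  ∃ φ : Formula m, ∀ (A : Type u) [NonUnitalCStarAlgebra A] (a : Fin m → A),
    (φ.eval a : ℝ) = g A a

namespace IsTermDefinable

variable {s t : ∀ (A : Type u) [NonUnitalCStarAlgebra A], (Fin m → A) → A}

theorem var (i : Fin m) : IsTermDefinable.{u} fun _ _ a => a i := ⟨.var i, fun _ _ _ => rfl⟩

theorem add (hs : IsTermDefinable s) (ht : IsTermDefinable t) :
    IsTermDefinable fun A _ a => s A a + t A a := by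
  obtain ⟨s', hs⟩ := hs
  obtain ⟨t', ht⟩ := ht
  exact ⟨.add s' t', fun A _ a => by rw [Term.eval, hs, ht]⟩

theorem mul (hs : IsTermDefinable s) (ht : IsTermDefinable t) :
    IsTermDefinable fun A _ a => s A a * t A a := by
  obtain ⟨s', hs⟩ := hs
  obtain ⟨t', ht⟩ := ht
  exact ⟨.mul s' t', fun A _ a => by rw [Term.eval, hs, ht]⟩

theorem smul (c : ℂ) (hs : IsTermDefinable s) : IsTermDefinable fun A _ a => c • s A a := by
  obtain ⟨s', hs⟩ := hs
  exact ⟨.smul c s', fun A _ a => by rw [Term.eval, hs]⟩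

theorem star (hs : IsTermDefinable s) : IsTermDefinable fun A _ a => Star.star (s A a) := by
  obtain ⟨s', hs⟩ := hs
  exact ⟨.adj s', fun A _ a => by rw [Term.eval, hs]⟩

theorem sub (hs : IsTermDefinable s) (ht : IsTermDefinable t) :
    IsTermDefinable fun A _ a => s A a - t A a := by
  simpa [sub_eq_add_neg] using hs.add (ht.smul (-1))

theorem sum {κ : Type*} (S : Finset κ)
    {s : κ → ∀ (A : Type u) [NonUnitalCStarAlgebra A], (Fin m → A) → A}
    (hs : ∀ k ∈ S, IsTermDefinable (s k)) : IsTermDefinable fun A _ a => ∑ k ∈ S, s k A a := by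
  classical
  induction S using Finset.induction_on with
  | empty => exact ⟨.zero, fun A _ a => by simp [Term.eval]⟩
  | insert k S hk ih =>
    simp only [Finset.sum_insert hk]
    exact (hs k (Finset.mem_insert_self _ _)).add
      (ih fun j hj => hs j (Finset.mem_insert_of_mem hj))

theorem constr {F ι : Type*} [AddCommGroup F] [Module ℂ F] [Fintype ι] (b : Module.Basis ι ℂ F)
    {x : ι → ∀ (A : Type u) [NonUnitalCStarAlgebra A], (Fin m → A) → A}
    (hx : ∀ j, IsTermDefinable (x j)) (v : F) :
    IsTermDefinable fun A _ a => b.constr ℂ (fun j => x j A a) v := by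
  simp only [Module.Basis.constr_apply_fintype]
  exact sum _ fun j _ => (hx j).smul _

theorem norm (hs : IsTermDefinable s) : IsDefinable fun A _ a => ‖s A a‖ := by
  obtain ⟨s', hs⟩ := hs
  exact ⟨.norm s', fun A _ a => by rw [Formula.eval, hs, coe_nnnorm]⟩

end IsTermDefinable

namespace IsDefinable

variable {g h : ∀ (A : Type u) [NonUnitalCStarAlgebra A], (Fin m → A) → ℝ}

theorem const (c : ℝ≥0) : IsDefinable.{u} fun (A : Type u) _ (_ : Fin m → A) => (c : ℝ) :=
  ⟨.conn (.const _ c) (.norm .zero) (.norm .zero), fun A _ a => by simp [Formula.eval]⟩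

theorem add (hg : IsDefinable g) (hh : IsDefinable h) :
    IsDefinable fun A _ a => g A a + h A a := by
  obtain ⟨φ, hφ⟩ := hg
  obtain ⟨ψ, hψ⟩ := hh
  exact ⟨.conn ⟨fun p => p.1 + p.2, by fun_prop⟩ φ ψ,
    fun A _ a => by simp [Formula.eval, ← hφ, ← hψ]⟩

theorem const_mul {c : ℝ} (hc : 0 ≤ c) (hg : IsDefinable g) :
    IsDefinable fun A _ a => c * g A a := by
  obtain ⟨φ, hφ⟩ := hg
  lift c to ℝ≥0 using hc
  exact ⟨.conn ⟨fun p => c * p.1, by fun_prop⟩ φ φ, fun A _ a => by simp [Formula.eval, ← hφ]⟩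

/-- Truncated subtraction on `ℝ≥0` is itself a continuous connective. -/
theorem max_sub_zero (hg : IsDefinable g) (hh : IsDefinable h) :
    IsDefinable fun A _ a => max (g A a - h A a) 0 := by
  obtain ⟨φ, hφ⟩ := hg
  obtain ⟨ψ, hψ⟩ := hh
  exact ⟨.conn ⟨fun p => p.1 - p.2, by fun_prop⟩ φ ψ,
    fun A _ a => by simp [Formula.eval, ← hφ, ← hψ, NNReal.coe_sub_def]⟩

theorem min (hg : IsDefinable g) (hh : IsDefinable h) :
    IsDefinable fun A _ a => min (g A a) (h A a) := by
  obtain ⟨φ, hφ⟩ := hg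
  obtain ⟨ψ, hψ⟩ := hh
  exact ⟨.conn ⟨fun p => p.1 ⊓ p.2, by fun_prop⟩ φ ψ,
    fun A _ a => by simp [Formula.eval, ← hφ, ← hψ]⟩

theorem sum {κ : Type*} (S : Finset κ)
    {g : κ → ∀ (A : Type u) [NonUnitalCStarAlgebra A], (Fin m → A) → ℝ}
    (hg : ∀ k ∈ S, IsDefinable (g k)) : IsDefinable fun A _ a => ∑ k ∈ S, g k A a := by
  classical
  induction S using Finset.induction_on with
  | empty => simpa using const 0
  | insert k S hk ih =>
    simp only [Finset.sum_insert hk]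
    exact (hg k (Finset.mem_insert_self _ _)).add
      (ih fun j hj => hg j (Finset.mem_insert_of_mem hj))

/-- Connectives are binary, so the maximum is folded over a finset; the empty supremum is 0 in `ℝ≥0`
and in `ℝ`. -/
theorem iSup {κ : Type*} [Fintype κ]
    {g : κ → ∀ (A : Type u) [NonUnitalCStarAlgebra A], (Fin m → A) → ℝ}
    (hg : ∀ k, IsDefinable (g k)) : IsDefinable fun A _ a => ⨆ k, g k A a := by
  classical
  choose φ hφ using hg
  have key : ∀ S : Finset κ, ∃ ψ : Formula m, ∀ (A : Type u) [NonUnitalCStarAlgebra A]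
      (a : Fin m → A), ψ.eval a = S.sup fun k => (φ k).eval a := by
    intro S
    induction S using Finset.induction_on with
    | empty => exact ⟨.norm .zero, fun A _ a => by simp [Formula.eval, Term.eval]⟩
    | insert k S hk ih =>
      obtain ⟨ψ, hψ⟩ := ih
      exact ⟨.conn ⟨fun p => p.1 ⊔ p.2, by fun_prop⟩ (φ k) ψ,
        fun A _ a => by simp [Formula.eval, hψ]⟩
  obtain ⟨ψ, hψ⟩ := key Finset.univ
  refine ⟨ψ, fun A _ a => ?_⟩
  simp only [hψ, ← hφ]
  apply le_antisymm
  · rw [← NNReal.coe_iSup, NNReal.coe_le_coe]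
    exact Finset.sup_le fun k _ => le_ciSup (f := fun k => (φ k).eval a)
      (Set.finite_range _).bddAbove k
  · exact Real.iSup_le (fun k => NNReal.coe_le_coe.2
      (Finset.le_sup (f := fun k => (φ k).eval a) (Finset.mem_univ k))) (NNReal.coe_nonneg _)

end IsDefinable

/-- Variables are bound from the last one on, and an infimum of infima is the infimum over tuples.
-/
theorem exists_formula_isGLB (k : ℕ) (φ : Formula (n + m)) :
    ∃ ψ : Formula n, ∀ (A : Type u) [NonUnitalCStarAlgebra A] (a : Fin n → A),
      IsGLB {r | ∃ y : Fin m → A, (∀ j, ‖y j‖ ≤ k) ∧ r = φ.eval (Fin.append a y)} (ψ.eval a) := by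
  induction m with
  | zero =>
    refine ⟨φ, fun A _ a => ?_⟩
    convert isGLB_singleton using 1
    ext r
    simp only [Set.mem_ofPred_eq, Set.mem_singleton_iff]
    constructor
    · rintro ⟨y, -, rfl⟩
      rw [Fin.append_right_nil _ _ rfl]; rfl
    · rintro rfl
      exact ⟨Fin.elim0, fun j => j.elim0, by rw [Fin.append_right_nil _ _ rfl]; rfl⟩
  | succ m ih =>
    obtain ⟨ψ, hψ⟩ := ih (.inf k φ)
    refine ⟨ψ, fun A _ a => ⟨?_, fun l hl => (hψ A a).2 ?_⟩⟩
    · rintro r ⟨y, hy, rfl⟩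
      refine ((hψ A a).1 ⟨Fin.init y, fun j => hy _, rfl⟩).trans ?_
      have h := ciInf_le (f := fun x : {x : A // ‖x‖ ≤ k} =>
        φ.eval (Fin.snoc (α := fun _ => A) (Fin.append a (Fin.init y)) x.1))
        (OrderBot.bddBelow _) ⟨y (Fin.last m), hy _⟩
      refine h.trans (le_of_eq ?_)
      simp only
      rw [← Fin.append_snoc, Fin.snoc_init_self]
    · rintro r ⟨y, hy, rfl⟩
      have : Nonempty {x : A // ‖x‖ ≤ k} := ⟨0, by simp⟩
      refine le_ciInf fun x => hl ⟨Fin.snoc (α := fun _ => A) y x.1, fun j => ?_, ?_⟩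
      · refine Fin.lastCases ?_ (fun j => ?_) j
        · simpa using x.2
        · simpa using hy j
      · rw [Fin.append_snoc]

theorem isDefinable_scalarDefect {s t : ∀ (A : Type u) [NonUnitalCStarAlgebra A], (Fin m → A) → A}
    (hs : IsTermDefinable s) (ht : IsTermDefinable t) :
    IsDefinable fun A _ a => scalarDefect (s A a) (t A a) := by
  unfold scalarDefect
  exact ((ht.sub ht.star).norm.add (ht.sub (hs.mul ht)).norm).add
    (((hs.add ht).norm.add (hs.sub ht).norm).max_sub_zero (by simpa using IsDefinable.const 2))

variable {F ι : Type*} [NonUnitalCStarAlgebra F] [Fintype ι]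

theorem isDefinable_relDefect (b : Module.Basis ι ℂ F) (N : Finset F)
    {x : ι → ∀ (A : Type u) [NonUnitalCStarAlgebra A], (Fin m → A) → A}
    (hx : ∀ j, IsTermDefinable (x j)) :
    IsDefinable fun A _ a => relDefect b N fun j => x j A a := by
  unfold relDefect
  refine (IsDefinable.add ?_ ?_).add ?_
  · exact .sum _ fun j _ => .sum _ fun k _ => (((hx j).mul (hx k)).sub (.constr b hx _)).norm
  · exact .sum _ fun j _ => ((hx j).star.sub (.constr b hx _)).norm
  · exact .sum _ fun v _ => .max_sub_zero (by simpa using IsDefinable.const 1)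
      (.const_mul zero_le_two (IsTermDefinable.constr b hx v).norm)

theorem isDefinable_gauge (b : Module.Basis ι ℂ F) (N : Finset F) (u : F) (L : ℝ)
    {C₁ C₂ : ℝ} (h₁ : 0 ≤ C₁) (h₂ : 0 ≤ C₂)
    {y : Fin n → ∀ (A : Type u) [NonUnitalCStarAlgebra A], (Fin m → A) → A}
    {x : ι → ∀ (A : Type u) [NonUnitalCStarAlgebra A], (Fin m → A) → A}
    {z w : Fin n → ι → ∀ (A : Type u) [NonUnitalCStarAlgebra A], (Fin m → A) → A}
    (hy : ∀ i, IsTermDefinable (y i)) (hx : ∀ j, IsTermDefinable (x j))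
    (hz : ∀ i j, IsTermDefinable (z i j)) (hw : ∀ i j, IsTermDefinable (w i j)) :
    IsDefinable fun A _ a => gauge b N u L C₁ C₂ (fun i => y i A a) (fun j => x j A a)
      (fun i j => z i j A a) (fun i j => w i j A a) := by
  unfold gauge
  refine (IsDefinable.add ?_ (.const_mul h₁ (isDefinable_relDefect b N hx))).add
    (.const_mul h₂ (.sum _ fun i _ => .sum _ fun k _ => ?_))
  · exact .iSup fun i => ((hy i).sub (.sum _ fun k _ =>
      (((hz i k).add ((hw i k).smul _)).mul (hx k)).smul _)).norm
  · exact (isDefinable_scalarDefect (.constr b hx _) (hz i k)).add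
      (isDefinable_scalarDefect (.constr b hx _) (hw i k))

end Definable

/-! ### The formula for the distance to the copies. -/

theorem exists_finset_net (F : Type*) [NonUnitalCStarAlgebra F] [FiniteDimensional ℂ F] :
    ∃ N : Finset F, (∀ v ∈ N, ‖v‖ = 1) ∧ ∀ v : F, ‖v‖ = 1 → ∃ e ∈ N, ‖v - e‖ < 1 / 4 := by
  have := FiniteDimensional.proper ℂ F
  obtain ⟨t, ht1, ht2, ht3⟩ := (isCompact_sphere (0 : F) 1).finite_cover_balls
    (by norm_num : (0 : ℝ) < 1 / 4)
  refine ⟨ht2.toFinset, fun v hv => ?_, fun v hv => ?_⟩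
  · simpa using ht1 (ht2.mem_toFinset.1 hv)
  · obtain ⟨e, he, hve⟩ := Set.mem_iUnion₂.1 (ht3 (by simpa using hv : v ∈ Metric.sphere 0 1))
    exact ⟨e, ht2.mem_toFinset.2 he, by rwa [← dist_eq_norm]⟩

/-- The distance of a tuple to the copies of `F` is given by a formula. -/
theorem exists_formula_copyDist (F : Type*) [NonUnitalCStarAlgebra F] [FiniteDimensional ℂ F]
    (n : ℕ) : ∃ β : Formula n, ∀ (A : Type u) [NonUnitalCStarAlgebra A] (a : Fin n → A),
      (∀ i, ‖a i‖ ≤ 1) → (β.eval a : ℝ) = copyDist F a := by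
  obtain ⟨-, -, -, u, hu, -, hsu, -, -⟩ := exists_separability_idempotent F
  obtain ⟨N, hN1, hN2⟩ := exists_finset_net F
  let b := Module.finBasis ℂ F
  -- K is a natural number because quantifiers range over balls of natural radius.
  obtain ⟨K, hK⟩ := exists_nat_ge (1 + ∑ j, ‖b j‖)
  have hK1 : (1 : ℝ) ≤ K := by
    have : 0 ≤ ∑ j, ‖b j‖ := by positivity
    linarith
  have hKb : ∀ j, ‖b j‖ ≤ K := fun j => by
    have := Finset.single_le_sum (f := fun j => ‖b j‖) (fun _ _ => norm_nonneg _)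
      (Finset.mem_univ j)
    linarith
  obtain ⟨L, hL, hupper⟩ := exists_gauge_le b hN1 hu hsu hK1 hKb
  obtain ⟨C₁, C₂, hC₁, hC₂, hlower⟩ := exists_copyDist_le_gauge b hN2 hu hsu hK1 hKb hL
  let ι := Fin (Module.finrank ℂ F)
  let e : (ι ⊕ (Fin n × ι) ⊕ (Fin n × ι)) ≃ Fin (Fintype.card (ι ⊕ (Fin n × ι) ⊕ (Fin n × ι))) :=
    Fintype.equivFin _
  obtain ⟨φ, hφ⟩ := isDefinable_gauge.{u} b N u L hC₁ hC₂
    (y := fun i _ _ a => a (Fin.castAdd _ i))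
    (x := fun j _ _ a => a (Fin.natAdd n (e (.inl j))))
    (z := fun i j _ _ a => a (Fin.natAdd n (e (.inr (.inl (i, j))))))
    (w := fun i j _ _ a => a (Fin.natAdd n (e (.inr (.inr (i, j))))))
    (fun _ => .var _) (fun _ => .var _) (fun _ _ => .var _) (fun _ _ => .var _)
  obtain ⟨ψ, hψ⟩ := exists_formula_isGLB.{u} K φ
  -- The cut-off matches the value 1 inserted in `copyDist`, also when A contains no copy.
  obtain ⟨β, hβ⟩ := IsDefinable.min.{u} ⟨ψ, fun _ _ _ => rfl⟩ (by simpa using IsDefinable.const 1)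
  refine ⟨β, fun A _ a ha => ?_⟩
  rw [hβ]
  apply le_antisymm
  · refine le_csInf (Set.insert_nonempty _ _) ?_
    rintro r (rfl | ⟨χ, hχ, rfl⟩)
    · exact min_le_right _ _
    set r := ⨆ i, Metric.infDist (a i) (Set.range χ) with hr
    have hr0 : 0 ≤ r := Real.iSup_nonneg fun i => Metric.infDist_nonneg
    by_cases hr1 : 1 ≤ r
    · exact (min_le_right _ _).trans hr1
    -- The room above r provides points of the copy at distance less than s from the `a i`.
    have key : ∀ s, r < s → s ≤ 2 → (ψ.eval a : ℝ) ≤ s := by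
      intro s hs hs2
      obtain ⟨x, z, w, hx, hz, hw, hle⟩ := hupper C₁ C₂ A n a ha χ hχ s hs2
        (fun i => (le_ciSup (f := fun i => Metric.infDist (a i) (Set.range χ))
          (Set.finite_range _).bddAbove i).trans_lt hs) (hr0.trans hs.le)
      let y := fun j => Sum.elim x (Sum.elim (fun p : Fin n × ι => z p.1 p.2)
        (fun p : Fin n × ι => w p.1 p.2)) (e.symm j)
      have hy : ∀ j, ‖y j‖ ≤ K := fun j => by
        simp only [y]
        rcases e.symm j with j | p | p
        exacts [hx j, hz _ _, hw _ _]
      have h1 : (ψ.eval a : ℝ) ≤ φ.eval (Fin.append a y) :=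
        NNReal.coe_le_coe.2 ((hψ A a).1 ⟨y, hy, rfl⟩)
      rw [hφ] at h1
      simp only [Fin.append_left, Fin.append_right, y, e.symm_apply_apply, Sum.elim_inl,
        Sum.elim_inr] at h1
      exact h1.trans hle
    refine (min_le_left _ _).trans (le_of_forall_gt_imp_ge_of_dense fun s hs => ?_)
    exact (key _ (lt_min hs (by linarith)) (min_le_right s 2)).trans (min_le_left _ _)
  · refine le_min ?_ (copyDist_le_one a)
    have h0 : 0 ≤ copyDist F a := by
      refine Real.sInf_nonneg ?_
      rintro r (rfl | ⟨φ, -, rfl⟩)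
      · exact zero_le_one
      · exact Real.iSup_nonneg fun i => Metric.infDist_nonneg
    rw [← Real.coe_toNNReal _ h0, NNReal.coe_le_coe]
    refine (hψ A a).2 ?_
    rintro r ⟨y, hy, rfl⟩
    rw [← NNReal.coe_le_coe, Real.coe_toNNReal _ h0, hφ]
    simp only [Fin.append_left, Fin.append_right]
    exact hlower A n a _ _ _ (fun _ => hy _) (fun _ _ => hy _) (fun _ _ => hy _)

end CStarLogic

/-! ### Omitting the types is being LF. -/

namespace CStarLogic

/-- The structure of a C*-algebra transports along a bijection. -/
theorem exists_nonUnitalCStarAlgebra_of_equiv {F B : Type*} [NonUnitalCStarAlgebra B]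
    (f : F ≃ B) : ∃ (_ : NonUnitalCStarAlgebra F) (φ : F →⋆ₙₐ[ℂ] B), Function.Bijective φ := by
  let _ : NonUnitalRing F := f.nonUnitalRing
  let _ : Module ℂ F := f.module ℂ
  let _ : Star F := ⟨fun x => f.symm (star (f x))⟩
  let φ₀ : F →ₙ+* B := f.ringEquiv
  let _ : NonUnitalNormedRing F := NonUnitalNormedRing.induced F B φ₀ f.injective
  have hmul (x y : F) : f (x * y) = f x * f y := map_mul φ₀ x y
  have hadd (x y : F) : f (x + y) = f x + f y := map_add φ₀ x y
  have hsmul (c : ℂ) (x : F) : f (c • x) = c • f x := f.apply_symm_apply _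
  have hstar (x : F) : f (star x) = star (f x) := f.apply_symm_apply _
  have hnorm (x : F) : ‖x‖ = ‖f x‖ := rfl
  have hiso : Isometry f := AddMonoidHomClass.isometry_of_norm φ₀ fun x => (hnorm x).symm
  let _ : StarRing F :=
    { star_involutive := fun x => f.injective (by simp only [hstar, star_star])
      star_mul := fun x y => f.injective (by simp only [hstar, hmul, star_mul])
      star_add := fun x y => f.injective (by simp only [hstar, hadd, star_add]) }
  have : CompleteSpace F := (completeSpace_congr hiso.isUniformInducing.isUniformEmbedding).2
    inferInstance
  let i : NonUnitalCStarAlgebra F :=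
    { norm_mul_self_le := fun x => by
        rw [hnorm, hnorm, hmul, hstar, CStarRing.norm_star_mul_self]
      norm_smul_le := fun c x => by rw [hnorm, hnorm, hsmul, norm_smul]
      smul_assoc := fun c x y => f.injective (by
        simp only [smul_eq_mul, hsmul, hmul, smul_mul_assoc])
      smul_comm := fun c x y => f.injective (by
        simp only [smul_eq_mul, hsmul, hmul, mul_smul_comm])
      star_smul := fun c x => f.injective (by simp only [hstar, hsmul, star_smul]) }
  let φ : F →⋆ₙₐ[ℂ] B :=
    { toFun := f
      map_smul' := hsmul
      map_zero' := map_zero φ₀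
      map_add' := hadd
      map_mul' := hmul
      map_star' := hstar }
  exact ⟨i, φ, f.bijective⟩

/-- A finite-dimensional *-subalgebra is the image of a C*-algebra in the lowest universe. -/
theorem exists_injective_range_eq {A : Type u} [NonUnitalCStarAlgebra A]
    (B : NonUnitalStarSubalgebra ℂ A) [FiniteDimensional ℂ B] :
    ∃ (F : Type) (_ : NonUnitalCStarAlgebra F) (_ : FiniteDimensional ℂ F) (φ : F →⋆ₙₐ[ℂ] A),
      Function.Injective φ ∧ Set.range φ = B := by
  -- Closedness makes B complete, hence itself a C*-algebra.
  have hclosed : IsClosed (B : Set A) :=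
    Submodule.closed_of_finiteDimensional B.toNonUnitalSubalgebra.toSubmodule
  -- A coordinate space over ℂ is a model of B in the universe over which the types quantify.
  obtain ⟨F, ⟨f⟩⟩ : ∃ F : Type, Nonempty (F ≃ B) :=
    ⟨_, ⟨(Module.finBasis ℂ B).equivFun.symm.toEquiv⟩⟩
  obtain ⟨i, φ, hφ⟩ := exists_nonUnitalCStarAlgebra_of_equiv f
  refine ⟨F, i, ?_, (NonUnitalStarSubalgebraClass.subtype B).comp φ,
    Subtype.val_injective.comp hφ.injective, ?_⟩
  · exact FiniteDimensional.of_injective (φ : F →ₗ[ℂ] B) hφ.injective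
  · rw [NonUnitalStarAlgHom.coe_comp, hφ.surjective.range_comp]
    exact Subtype.range_coe

theorem isLF_of_omits {β : FormulaFamily}
    (hβ : ∀ (F : Type) [NonUnitalCStarAlgebra F] [FiniteDimensional ℂ F] (n : ℕ)
      (A : Type u) [NonUnitalCStarAlgebra A] (a : Fin n → A), (∀ i, ‖a i‖ ≤ 1) →
      ((β F n).eval a : ℝ) = copyDist F a) (A : Type u) [NonUnitalCStarAlgebra A]
    (h : ∀ m n : ℕ, 1 ≤ m → Omits A (lfType β m n)) : IsLF A := by
  intro S ε hε
  -- Dividing by R moves S into the unit ball; scaling back turns 1/m into R/m ≤ ε.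
  set R : ℝ := 1 + ∑ a ∈ S, ‖a‖ with hR
  have hR0 : 0 < R := by positivity
  obtain ⟨m, hm⟩ := exists_nat_ge (R / ε)
  let f : Fin S.card ≃ S := S.equivFin.symm
  let a : Fin S.card → A := fun i => ((R⁻¹ : ℝ) : ℂ) • (f i : A)
  have ha : ∀ i, ‖a i‖ ≤ 1 := fun i => by
    have : ‖(f i : A)‖ ≤ R := by
      have := Finset.single_le_sum (f := fun a : A => ‖a‖) (fun _ _ => norm_nonneg _) (f i).2
      linarith
    rw [norm_smul, Complex.norm_real, norm_inv, Real.norm_of_nonneg hR0.le, inv_mul_le_one₀ hR0]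
    exact this
  have hm0 : 0 < m := by
    have : (0 : ℝ) < m := (by positivity : 0 < R / ε).trans_le hm
    exact_mod_cast this
  have hF : ∃ (F : Type) (_ : NonUnitalCStarAlgebra F) (_ : FiniteDimensional ℂ F),
      copyDist F a < 1 / m := by
    by_contra! hcon
    refine h m S.card hm0 ⟨a, ha, ?_⟩
    rintro c (⟨F, i1, i2, rfl⟩ | ⟨i, rfl⟩)
    · rw [Condition.Holds, ← NNReal.coe_le_coe, hβ F S.card A a ha]
      simpa using hcon F i1 i2
    · rw [Condition.Holds, Formula.eval, ← NNReal.coe_le_coe]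
      exact ha i
  obtain ⟨F, i1, i2, hF⟩ := hF
  obtain ⟨r, hr, hrm⟩ := exists_lt_of_csInf_lt (Set.insert_nonempty _ _) hF
  -- This excludes the default value 1, so an actual copy witnesses the bound.
  have hm1 : 1 / (m : ℝ) ≤ 1 := by
    rw [div_le_one (by exact_mod_cast hm0)]; exact_mod_cast hm0
  obtain rfl | ⟨φ, -, rfl⟩ := hr
  · linarith
  refine ⟨NonUnitalStarAlgHom.range φ, ?_, fun s hs => ?_⟩
  · exact Module.Finite.range (φ : F →ₗ[ℂ] A)
  · obtain ⟨i, hi⟩ := f.surjective ⟨s, hs⟩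
    have h1 : Metric.infDist (a i) (Set.range φ) < 1 / m :=
      (le_ciSup (f := fun i => Metric.infDist (a i) (Set.range φ))
        (Set.finite_range _).bddAbove i).trans_lt hrm
    obtain ⟨-, ⟨y, rfl⟩, hy⟩ := (Metric.infDist_lt_iff (Set.range_nonempty φ)).1 h1
    refine ⟨φ ((R : ℂ) • y), ⟨_, rfl⟩, ?_⟩
    have e : s - φ ((R : ℂ) • y) = (R : ℂ) • (a i - φ y) := by
      have : (R : ℂ) ≠ 0 := by exact_mod_cast hR0.ne'
      simp only [a, hi, map_smul, smul_sub, smul_smul]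
      rw [Complex.ofReal_inv, mul_inv_cancel₀ this, one_smul]
    rw [e, norm_smul, Complex.norm_real, Real.norm_of_nonneg hR0.le, ← dist_eq_norm]
    calc R * dist (a i) (φ y) < R * (1 / m) := by gcongr
      _ ≤ ε := by
        rw [mul_one_div, div_le_iff₀ (by exact_mod_cast hm0)]
        rwa [div_le_iff₀ hε, mul_comm] at hm

theorem omits_of_isLF {β : FormulaFamily}
    (hβ : ∀ (F : Type) [NonUnitalCStarAlgebra F] [FiniteDimensional ℂ F] (n : ℕ)
      (A : Type u) [NonUnitalCStarAlgebra A] (a : Fin n → A), (∀ i, ‖a i‖ ≤ 1) →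
      ((β F n).eval a : ℝ) = copyDist F a) (A : Type u) [NonUnitalCStarAlgebra A]
    (h : IsLF A) {m n : ℕ} (hm : 1 ≤ m) : Omits A (lfType β m n) := by
  classical
  rintro ⟨a, ha, hc⟩
  have hm' : (0 : ℝ) < m := by exact_mod_cast hm
  -- Half of 1/m, to contradict the non-strict condition ≥ 1/m.
  obtain ⟨B, hB, hdist⟩ := h (Finset.univ.image a) (1 / (2 * m)) (by positivity)
  obtain ⟨F, i1, i2, φ, hφ, hrange⟩ := exists_injective_range_eq B
  have h1 := hc _ (Or.inl ⟨F, i1, i2, rfl⟩)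
  rw [Condition.Holds, ← NNReal.coe_le_coe, hβ F n A a ha] at h1
  have h2 : copyDist F a ≤ 1 / (2 * m) := copyDist_le_of_injective a hφ (by positivity) fun i => by
    obtain ⟨b, hb, hab⟩ := hdist (a i) (by simp)
    obtain ⟨y, rfl⟩ : b ∈ Set.range φ := by rw [hrange]; exact hb
    exact ⟨y, hab.le⟩
  have h3 : 1 / (2 * m : ℝ) < 1 / m := by
    apply one_div_lt_one_div_of_lt hm'; linarith
  push_cast at h1
  linarith

end CStarLogic

theorem theoremT :
    ∃ T : Set (Σ n : ℕ, CStarLogic.NType n),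
      T.Countable ∧
      (∃ β : CStarLogic.FormulaFamily,
        (∀ (F : Type) [NonUnitalCStarAlgebra F] [FiniteDimensional ℂ F] (n : ℕ)
            (A : Type u) [NonUnitalCStarAlgebra A] (a : Fin n → A), (∀ i, ‖a i‖ ≤ 1) →
            ((β F n).eval a : ℝ) = CStarLogic.copyDist F a) ∧
        T = {t | ∃ m n : ℕ, 1 ≤ m ∧ t = ⟨n, CStarLogic.lfType β m n⟩}) ∧
      ∀ (A : Type u) [NonUnitalCStarAlgebra A] [TopologicalSpace.SeparableSpace A],
        CStarLogic.IsLF A ↔ ∀ t ∈ T, CStarLogic.Omits A t.2 := by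
  choose β hβ using fun (F : Type) [NonUnitalCStarAlgebra F] [FiniteDimensional ℂ F] (n : ℕ) =>
    CStarLogic.exists_formula_copyDist.{u} F n
  refine ⟨{t | ∃ m n : ℕ, 1 ≤ m ∧ t = ⟨n, CStarLogic.lfType β m n⟩}, ?_, ⟨β, hβ, rfl⟩,
    fun A _ _ => ⟨?_, fun h => ?_⟩⟩
  · refine (Set.countable_range
      fun p : ℕ × ℕ => (⟨p.2, CStarLogic.lfType β p.1 p.2⟩ : Σ n, CStarLogic.NType n)).mono ?_
    rintro t ⟨m, n, -, rfl⟩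
    exact ⟨(m, n), rfl⟩
  · rintro h t ⟨m, n, hm, rfl⟩
    exact CStarLogic.omits_of_isLF hβ A h hm
  · exact CStarLogic.isLF_of_omits hβ A fun m n hm => h _ ⟨m, n, hm, rfl⟩
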